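/- **Theorem.** A family $\mathcal F=\{B_1,\dots,B_n\}$ of subsets of $[m]$ is an $(n,m,d,k,\alpha)$-Robust UFF if $|B_i|=d$ for all $i$ and $|B_{j_0}\cap(B_{j_1}\cup\dots\cup B_{j_k})|<\alpha|B_{j_0}|$ for all distinct $j_0,\dots,j_k\in[n]$. There are one deterministic algorithm and absolute constants $C,c$ such that for all integers $n\ge 2$, $k\ge 1$ and all real $\alpha\in(0,1]$ the algorithm, given $n$, $k$ and $\alpha$, writes out (all $n$ sets, as lists of their elements, together with $m$ and $d$) an $(n,m,d,k,\alpha)$-Robust UFF with $$m\le C\,\frac{k^2\log n}{\alpha^2},\qquad d\le C\,\frac{k\log n}{\alpha},$$ in time at most $$C\,n\cdot\frac{k\log n}{\alpha}.$$ Here $\alpha$ is given to the algorithm as a fraction $a/b$ of positive integers with $\alpha/2\le a/b\le\alpha$ (for rational $\alpha$ one may take $a/b=\alpha$). Time is the number of steps of a random access machine on which each arithmetic operation ($+$, truncated $-$, $\times$, integer quotient and remainder), memory access and comparison is one step, and every number that occurs during the computation is at most $(n+k+b)^{c}$ (words of $O(\log(n+k+b))$ bits). -/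

import Mathlib

/-- The family `F 0, …, F (n - 1)` of subsets of `[m]` is an `(n, m, d, k, α)`-Robust-UFF. -/
def IsRobustUFF {n m : ℕ} (F : Fin n → Finset (Fin m)) (d k : ℕ) (α : ℝ) : Prop :=
  (∀ i, (F i).card = d) ∧
    ∀ j : Fin (k + 1) → Fin n, Function.Injective j →
      (((F (j 0)) ∩ Finset.univ.biUnion (fun i : Fin k => F (j i.succ))).card : ℝ)
        < α * ((F (j 0)).card : ℝ)

namespace WordRAM

/-- Arithmetic instructions (truncated subtraction, quotient and remainder of division). -/
inductive Op
  | add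
  | sub
  | mul
  | div
  | mod

def Op.eval : Op → ℕ → ℕ → ℕ
  | .add, x, y => x + y
  | .sub, x, y => x - y
  | .mul, x, y => x * y
  | .div, x, y => x / y
  | .mod, x, y => x % y

/-- Contents of the registers and of the random access memory; each cell holds one natural
number. A program mentions finitely many registers. -/
structure State where
  reg : ℕ → ℕ
  mem : ℕ → ℕ

def State.setReg (s : State) (i v : ℕ) : State :=
  ⟨Function.update s.reg i v, s.mem⟩

def State.setMem (s : State) (p v : ℕ) : State :=
  ⟨s.reg, Function.update s.mem p v⟩

/-- Structured RAM programs; `i`, `j`, `l` are register numbers. -/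
inductive Program
  /-- do nothing -/
  | skip
  /-- `Rᵢ := v` -/
  | const (i v : ℕ)
  /-- `Rᵢ := Rⱼ o Rₗ` -/
  | arith (o : Op) (i j l : ℕ)
  /-- `Rᵢ := M[Rⱼ]` -/
  | load (i j : ℕ)
  /-- `M[Rᵢ] := Rⱼ` -/
  | store (i j : ℕ)
  /-- sequential composition -/
  | seq (P Q : Program)
  /-- `if Rᵢ < Rⱼ then P else Q` -/
  | ite (i j : ℕ) (P Q : Program)
  /-- `while Rᵢ < Rⱼ do P` -/
  | loop (i j : ℕ) (P : Program)

/-- `Exec B P s t s'`: the program `P`, started in state `s`, halts in state `s'` after exactly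
`t` steps, and every number that it computes on the way is at most `B`. Each elementary instruction
and each evaluation of a test is one step. -/
inductive Exec (B : ℕ) : Program → State → ℕ → State → Prop
  | skip (s : State) : Exec B .skip s 1 s
  | const (s : State) (i v : ℕ) (h : v ≤ B) : Exec B (.const i v) s 1 (s.setReg i v)
  | arith (s : State) (o : Op) (i j l : ℕ) (h : o.eval (s.reg j) (s.reg l) ≤ B) :
      Exec B (.arith o i j l) s 1 (s.setReg i (o.eval (s.reg j) (s.reg l)))
  | load (s : State) (i j : ℕ) : Exec B (.load i j) s 1 (s.setReg i (s.mem (s.reg j)))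
  | store (s : State) (i j : ℕ) : Exec B (.store i j) s 1 (s.setMem (s.reg i) (s.reg j))
  | seq {P Q : Program} {s s' s'' : State} {t t' : ℕ}
      (hP : Exec B P s t s') (hQ : Exec B Q s' t' s'') : Exec B (.seq P Q) s (t + t') s''
  | ite_true {P Q : Program} {s s' : State} {t i j : ℕ} (h : s.reg i < s.reg j)
      (hP : Exec B P s t s') : Exec B (.ite i j P Q) s (t + 1) s'
  | ite_false {P Q : Program} {s s' : State} {t i j : ℕ} (h : ¬ s.reg i < s.reg j)
      (hQ : Exec B Q s t s') : Exec B (.ite i j P Q) s (t + 1) s'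
  | loop_stop {P : Program} {s : State} {i j : ℕ} (h : ¬ s.reg i < s.reg j) :
      Exec B (.loop i j P) s 1 s
  | loop_step {P : Program} {s s' s'' : State} {t t' i j : ℕ} (h : s.reg i < s.reg j)
      (hP : Exec B P s t s') (hL : Exec B (.loop i j P) s' t' s'') :
      Exec B (.loop i j P) s (t + t' + 1) s''

/-- The start state: the input stands in the first registers, everything else is `0`. -/
def start (input : List ℕ) : State :=
  ⟨fun i => input.getD i 0, fun _ => 0⟩

/-- The state `s` holds the family `F` of `d`-element subsets of `[m]` as its output: `R₀ = m`,
`R₁ = d`, and the memory from address `R₂` on lists the elements of `F 0`, then those of `F 1`,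
and so on, `d` cells for each set. -/
def State.Outputs {n m : ℕ} (s : State) (d : ℕ) (F : Fin n → Finset (Fin m)) : Prop :=
  s.reg 0 = m ∧ s.reg 1 = d ∧
    ∀ i : Fin n, (F i).map Fin.valEmbedding =
      (Finset.range d).image (fun l => s.mem (s.reg 2 + (i : ℕ) * d + l))

end WordRAM

/-! Let `q = 2 ^ r` be the least power of two with `q a ≥ 3 k b`, so that `q ≥ 3k/α` and `q =
O(k/α)`, and let `D = ⌈log₂ n⌉`.

If `q² ≥ n`, then `n` disjoint singletons suffice, since `m = n ≤ q² = O(k²/α²)`.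

Otherwise the sets come from a linear code. Messages are the numbers below `2 ^ D`, letters are the
numbers below `q`, both are groups under bitwise xor, and every one of the `d = qD` coordinates
("columns") is an additive map. The set of `u` consists of one point `l q + col l u` in each block
`l`. Two sets meet in as many points as their words agree, that is, in the number of zeros of the
word of `u ^^^ v`. If every nonzero word has at most `3D - 1` zeros, then `k` sets cover at most `k
(3D - 1) < 3kD ≤ α d` points of another one (`isRobustUFF_codeSet`).

The code is found by derandomization. A nonzero message `v` carries the weight 2 to the number of
zeros of its word so far. A random additive map vanishes at each `v ≠ 0` with probability `1/q`, so
some column has zeros of total weight at most a `1/q` share (`IsColumn`). It is found by fixing the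
images of `1, 2, 4, …` in turn, each time taking the best value (`IsColumn.succ`). Each column
multiplies the total weight by at most `1 + 1/q`, so after `qD` columns it is below `2 ^ D (1 + 1/q)
^ (qD) ≤ 2 ^ D 4 ^ D = 2 ^ (3D)`, and no word has `3D` zeros (`run_writeCode`).

The image of `2 ^ i` is chosen in time `O(2 ^ i + q)`, so a column costs `O(2 ^ D + qD)`. This is
`O(n)` because `q² < n`, and all columns together cost `O(n q D)` (`familyTime_le`). -/

namespace WordRAM

/-! ### A program logic with time bounds -/

/-- Started in `s`, the program `P` halts after at most `T` steps in a state that satisfies `Q`. -/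
def Run (B : ℕ) (P : Program) (s : State) (T : ℕ) (Q : State → Prop) : Prop :=
  ∃ t s', Exec B P s t s' ∧ t ≤ T ∧ Q s'

@[simp] theorem State.setReg_reg (s : State) (i v r : ℕ) :
    (s.setReg i v).reg r = if r = i then v else s.reg r := by
  simp [State.setReg, Function.update_apply]

@[simp] theorem State.setReg_mem (s : State) (i v : ℕ) : (s.setReg i v).mem = s.mem := rfl

@[simp] theorem State.setMem_reg (s : State) (p v : ℕ) : (s.setMem p v).reg = s.reg := rfl

@[simp] theorem State.setMem_mem (s : State) (p v x : ℕ) :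
    (s.setMem p v).mem x = if x = p then v else s.mem x := by
  simp [State.setMem, Function.update_apply]

/-- The first `t` registers of `s` agree with those of `s₀`. -/
def Frame (t : ℕ) (s₀ s : State) : Prop := ∀ r < t, s.reg r = s₀.reg r

theorem Frame.refl (t : ℕ) (s : State) : Frame t s s := fun _ _ => rfl

theorem Frame.setReg {t i v : ℕ} {s₀ s : State} (h : Frame t s₀ s) (hi : t ≤ i) :
    Frame t s₀ (s.setReg i v) := fun r hr => by
  rw [State.setReg_reg, if_neg (by omega), h r hr]

theorem Frame.setMem {t p v : ℕ} {s₀ s : State} (h : Frame t s₀ s) :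
    Frame t s₀ (s.setMem p v) := h

theorem Frame.trans {t u : ℕ} {s₀ s₁ s₂ : State} (h : Frame t s₀ s₁) (h' : Frame u s₁ s₂)
    (htu : t ≤ u) : Frame t s₀ s₂ := fun r hr => (h' r (by omega)).trans (h r hr)

variable {B : ℕ} {P P' : Program} {s : State} {T T' : ℕ} {Q Q' : State → Prop}

theorem Run.mono (h : Run B P s T Q) (hT : T ≤ T') (hQ : ∀ s, Q s → Q' s) :
    Run B P s T' Q' := by
  obtain ⟨t, s', he, ht, hq⟩ := h
  exact ⟨t, s', he, ht.trans hT, hQ _ hq⟩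

theorem Run.seq (h : Run B P s T fun s' => Run B P' s' T' Q) : Run B (.seq P P') s (T + T') Q := by
  obtain ⟨t, s', he, ht, t', s'', he', ht', hq⟩ := h
  exact ⟨t + t', s'', .seq he he', by omega, hq⟩

theorem Run.const {i v : ℕ} (hv : v ≤ B) (h : Q (s.setReg i v)) : Run B (.const i v) s 1 Q :=
  ⟨1, _, .const s i v hv, le_rfl, h⟩

theorem Run.arith {o : Op} {i j l : ℕ} (v : ℕ) (he : o.eval (s.reg j) (s.reg l) = v) (hv : v ≤ B)
    (h : Q (s.setReg i v)) : Run B (.arith o i j l) s 1 Q := by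
  subst he
  exact ⟨1, _, .arith s o i j l hv, le_rfl, h⟩

theorem Run.load {i j : ℕ} (v : ℕ) (he : s.mem (s.reg j) = v) (h : Q (s.setReg i v)) :
    Run B (.load i j) s 1 Q := by
  subst he
  exact ⟨1, _, .load s i j, le_rfl, h⟩

theorem Run.store {i j : ℕ} (p v : ℕ) (hp : s.reg i = p) (hv : s.reg j = v)
    (h : Q (s.setMem p v)) : Run B (.store i j) s 1 Q := by
  subst hp hv
  exact ⟨1, _, .store s i j, le_rfl, h⟩

theorem Run.skip (h : Q s) : Run B .skip s 1 Q := ⟨1, s, .skip s, le_rfl, h⟩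

/-- The `_seq` forms execute one instruction and leave the rest of the program as the goal, so that
straight-line code is verified by symbolic execution. -/
theorem Run.const_seq {i v : ℕ} (hv : v ≤ B) (h : Run B P (s.setReg i v) T Q) :
    Run B (.seq (.const i v) P) s (T + 1) Q := by
  rw [add_comm]
  exact (Run.const (Q := fun s' => Run B P s' T Q) hv h).seq

theorem Run.arith_seq {o : Op} {i j l : ℕ} (v : ℕ) (he : o.eval (s.reg j) (s.reg l) = v)
    (hv : v ≤ B) (h : Run B P (s.setReg i v) T Q) :
    Run B (.seq (.arith o i j l) P) s (T + 1) Q := by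
  rw [add_comm]
  exact (Run.arith (Q := fun s' => Run B P s' T Q) v he hv h).seq

theorem Run.load_seq {i j : ℕ} (v : ℕ) (he : s.mem (s.reg j) = v)
    (h : Run B P (s.setReg i v) T Q) : Run B (.seq (.load i j) P) s (T + 1) Q := by
  rw [add_comm]
  exact (Run.load (Q := fun s' => Run B P s' T Q) v he h).seq

theorem Run.store_seq {i j : ℕ} (p v : ℕ) (hp : s.reg i = p) (hv : s.reg j = v)
    (h : Run B P (s.setMem p v) T Q) : Run B (.seq (.store i j) P) s (T + 1) Q := by
  rw [add_comm]
  exact (Run.store (Q := fun s' => Run B P s' T Q) p v hp hv h).seq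

theorem Run.ite {i j : ℕ} (h : s.reg i < s.reg j → Run B P s T Q)
    (h' : ¬ s.reg i < s.reg j → Run B P' s T Q) : Run B (.ite i j P P') s (T + 1) Q := by
  by_cases hc : s.reg i < s.reg j
  · obtain ⟨t, s', he, ht, hq⟩ := h hc
    exact ⟨t + 1, s', .ite_true hc he, by omega, hq⟩
  · obtain ⟨t, s', he, ht, hq⟩ := h' hc
    exact ⟨t + 1, s', .ite_false hc he, by omega, hq⟩

/-- The invariant is indexed by the number of finished rounds. The cost may depend on the round: in
`computeColumn` it grows like `2 ^ x`, and summing it exactly avoids a factor `D`. -/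
theorem Run.loop {i j : ℕ} (I : ℕ → State → Prop) (N : ℕ) (time : ℕ → ℕ)
    (test : ∀ x s, I x s → (s.reg i < s.reg j ↔ x < N))
    (step : ∀ x < N, ∀ s, I x s → Run B P s (time x) (I (x + 1))) (init : I 0 s) :
    Run B (.loop i j P) s (∑ x ∈ Finset.range N, (time x + 1) + 1) (I N) := by
  suffices H : ∀ m x s, x + m = N → I x s →
      Run B (.loop i j P) s (∑ y ∈ Finset.range m, (time (x + y) + 1) + 1) (I N) by
    simpa using H N 0 s (by omega) init
  intro m
  induction m with
  | zero =>
    intro x s hx hI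
    have hx' : x = N := by omega
    subst hx'
    exact ⟨1, s, by constructor; rw [test _ _ hI]; omega, by simp, hI⟩
  | succ m ih =>
    intro x s hx hI
    obtain ⟨t, s', he, ht, hI'⟩ := step x (by omega) s hI
    obtain ⟨t', s'', he', ht', hI''⟩ := ih (x + 1) s' (by omega) hI'
    refine ⟨t + t' + 1, s'', .loop_step ((test _ _ hI).2 (by omega)) he he', ?_, hI''⟩
    rw [Finset.sum_range_succ']
    have : ∀ y, x + 1 + y = x + (y + 1) := by intro y; omega
    simp only [this] at ht'
    simp only [add_zero]
    omega

theorem Run.loop_const {i j : ℕ} (I : ℕ → State → Prop) (N : ℕ) (T : ℕ)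
    (test : ∀ x s, I x s → (s.reg i < s.reg j ↔ x < N))
    (step : ∀ x < N, ∀ s, I x s → Run B P s T (I (x + 1))) (init : I 0 s) :
    Run B (.loop i j P) s (N * (T + 1) + 1) (I N) := by
  simpa using Run.loop I N (fun _ => T) test step init

end WordRAM

/-! ### Linear codes over elementary abelian 2-groups -/

/-- `A` is additive on `[0, 2 ^ i)`, takes values below `q`, and the total weight of its zeros
other than `0` is at most the fraction `1 / q` of the total weight. -/
structure IsColumn (i q : ℕ) (A w : ℕ → ℕ) : Prop where
  lt : ∀ u < 2 ^ i, A u < q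
  xor : ∀ u < 2 ^ i, ∀ v < 2 ^ i, A (u ^^^ v) = A u ^^^ A v
  light : q * ∑ v ∈ Finset.Ico 1 (2 ^ i), (if A v = 0 then w v else 0)
    ≤ ∑ v ∈ Finset.Ico 1 (2 ^ i), w v

theorem IsColumn.zero {i q : ℕ} {A w : ℕ → ℕ} (h : IsColumn i q A w) : A 0 = 0 := by
  have := h.xor 0 (by positivity) 0 (by positivity)
  simpa using this

/-- Identifies the upper half of `[0, 2 ^ (i + 1))` with the coset of `2 ^ i` modulo the subgroup
`[0, 2 ^ i)`. -/
theorem Nat.two_pow_xor_of_lt {i u : ℕ} (h : u < 2 ^ i) : 2 ^ i ^^^ u = 2 ^ i + u := by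
  have := Nat.two_pow_add_eq_or_of_lt h 1
  simp only [mul_one] at this
  rw [this]
  apply Nat.eq_of_testBit_eq
  intro j
  simp only [Nat.testBit_xor, Nat.testBit_or, Nat.testBit_two_pow]
  by_cases hj : i = j
  · subst hj
    simp [Nat.testBit_lt_two_pow h]
  · simp [hj]

theorem sum_Ico_two_pow_succ (i : ℕ) (f : ℕ → ℕ) :
    ∑ v ∈ Finset.Ico 1 (2 ^ (i + 1)), f v
      = ∑ v ∈ Finset.Ico 1 (2 ^ i), f v + ∑ u ∈ Finset.range (2 ^ i), f (2 ^ i + u) := by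
  have h1 : 1 ≤ 2 ^ i := Nat.one_le_two_pow
  rw [← Finset.sum_Ico_consecutive f h1 (Nat.pow_le_pow_right (by norm_num) (Nat.le_succ i)),
    Finset.sum_Ico_eq_sum_range f (2 ^ i)]
  congr 2
  congr 1
  rw [pow_succ]; omega

/-- The sum over the bucket `y`: the weight of the `2 ^ i + u` with `A u = y`. -/
def bucket (A w : ℕ → ℕ) (P N y : ℕ) : ℕ :=
  ∑ u ∈ Finset.range N, if A u = y then w (P + u) else 0

theorem bucket_le (A w : ℕ → ℕ) {P N N' : ℕ} (y : ℕ) (h : N ≤ N') :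
    bucket A w P N y ≤ ∑ u ∈ Finset.range N', w (P + u) :=
  (Finset.sum_le_sum fun u _ => by split_ifs <;> simp).trans
    (Finset.sum_le_sum_of_subset (by simpa using h))

/-- One greedy step. Additivity forces `x ^^^ A u` at `2 ^ i + u`, which vanishes exactly when `A u
= x`, so the weight of the new zeros is that of bucket `x`. The `2 ^ r` buckets partition the weight
of the upper half, hence the lightest one holds at most a `2 ^ r`-th part of it. -/
theorem IsColumn.succ {i r : ℕ} {A A' w : ℕ → ℕ} (h : IsColumn i (2 ^ r) A w) {x : ℕ}
    (hx : x < 2 ^ r) (hmin : ∀ y < 2 ^ r, bucket A w (2 ^ i) (2 ^ i) x ≤ bucket A w (2 ^ i) (2 ^ i) y)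
    (hold : ∀ u < 2 ^ i, A' u = A u) (hnew : ∀ u < 2 ^ i, A' (2 ^ i + u) = x ^^^ A u) :
    IsColumn (i + 1) (2 ^ r) A' w := by
  have hp : 2 ^ (i + 1) = 2 ^ i + 2 ^ i := by rw [pow_succ]; omega
  have key : ∀ u < 2 ^ (i + 1), u < 2 ^ i ∨ ∃ u' < 2 ^ i, u = 2 ^ i + u' := fun u hu => by
    rcases lt_or_ge u (2 ^ i) with h | h
    · exact .inl h
    · exact .inr ⟨u - 2 ^ i, by omega, by omega⟩
  refine ⟨fun u hu => ?_, fun u hu v hv => ?_, ?_⟩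
  · rcases key u hu with h' | ⟨u', h', rfl⟩
    · rw [hold _ h']; exact h.lt _ h'
    · rw [hnew _ h']; exact Nat.xor_lt_two_pow hx (h.lt _ h')
  · rcases key u hu with hu' | ⟨u', hu', rfl⟩ <;> rcases key v hv with hv' | ⟨v', hv', rfl⟩
    · rw [hold _ hu', hold _ hv', hold _ (Nat.xor_lt_two_pow hu' hv'), h.xor _ hu' _ hv']
    · have hx' := Nat.xor_lt_two_pow hu' hv'
      have e : u ^^^ (2 ^ i + v') = 2 ^ i + (u ^^^ v') := by
        rw [← Nat.two_pow_xor_of_lt hv', ← Nat.two_pow_xor_of_lt hx', Nat.xor_left_comm]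
      rw [e, hold _ hu', hnew _ hv', hnew _ hx', h.xor _ hu' _ hv', Nat.xor_left_comm]
    · have hx' := Nat.xor_lt_two_pow hu' hv'
      have e : (2 ^ i + u') ^^^ v = 2 ^ i + (u' ^^^ v) := by
        rw [← Nat.two_pow_xor_of_lt hu', ← Nat.two_pow_xor_of_lt hx', Nat.xor_assoc]
      rw [e, hold _ hv', hnew _ hu', hnew _ hx', h.xor _ hu' _ hv', Nat.xor_assoc]
    · have hx' := Nat.xor_lt_two_pow hu' hv'
      have e : (2 ^ i + u') ^^^ (2 ^ i + v') = u' ^^^ v' := by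
        rw [← Nat.two_pow_xor_of_lt hu', ← Nat.two_pow_xor_of_lt hv', Nat.xor_assoc,
          Nat.xor_left_comm u', ← Nat.xor_assoc, Nat.xor_self, Nat.zero_xor]
      rw [e, hnew _ hv', hnew _ hu', hold _ hx', h.xor _ hu' _ hv', Nat.xor_assoc,
        Nat.xor_left_comm (A u'), ← Nat.xor_assoc, Nat.xor_self, Nat.zero_xor]
  · have e1 : ∑ v ∈ Finset.Ico 1 (2 ^ i), (if A' v = 0 then w v else 0)
        = ∑ v ∈ Finset.Ico 1 (2 ^ i), (if A v = 0 then w v else 0) :=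
      Finset.sum_congr rfl fun v hv => by rw [hold v (Finset.mem_Ico.1 hv).2]
    have e2 : ∑ u ∈ Finset.range (2 ^ i), (if A' (2 ^ i + u) = 0 then w (2 ^ i + u) else 0)
        = bucket A w (2 ^ i) (2 ^ i) x :=
      Finset.sum_congr rfl fun u hu => by
        rw [hnew u (Finset.mem_range.1 hu)]
        simp only [Nat.xor_eq_zero_iff, eq_comm]
    have e3 : ∑ y ∈ Finset.range (2 ^ r), bucket A w (2 ^ i) (2 ^ i) y
        = ∑ u ∈ Finset.range (2 ^ i), w (2 ^ i + u) := by
      unfold bucket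
      rw [Finset.sum_comm]
      refine Finset.sum_congr rfl fun u hu => ?_
      rw [Finset.sum_ite_eq, if_pos (Finset.mem_range.2 (h.lt u (Finset.mem_range.1 hu)))]
    have e4 : 2 ^ r * bucket A w (2 ^ i) (2 ^ i) x
        ≤ ∑ y ∈ Finset.range (2 ^ r), bucket A w (2 ^ i) (2 ^ i) y := by
      have := Finset.card_nsmul_le_sum (Finset.range (2 ^ r)) (bucket A w (2 ^ i) (2 ^ i)) _
        fun y hy => hmin y (Finset.mem_range.1 hy)
      simpa using this
    rw [sum_Ico_two_pow_succ, sum_Ico_two_pow_succ, e1, e2, mul_add]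
    have := h.light
    omega

/-- The integer form of `(1 + 1/q) ^ j ≤ e ^ (j/q) ≤ e ^ D ≤ 4 ^ D`. -/
theorem succ_pow_le_four_pow_mul {q D j : ℕ} (hq : 0 < q) (hj : j ≤ q * D) :
    (q + 1) ^ j ≤ 4 ^ D * q ^ j := by
  have hq' : (0 : ℝ) < q := by exact_mod_cast hq
  have h1 : ((q : ℝ) + 1) ≤ q * Real.exp (1 / q) := by
    have := Real.add_one_le_exp (1 / (q : ℝ))
    calc (q : ℝ) + 1 = q * (1 / q + 1) := by field_simp; ring
      _ ≤ _ := by gcongr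
  have h2 : Real.exp (1 / q) ^ j ≤ 4 ^ D := by
    rw [← Real.exp_nat_mul]
    calc Real.exp (j * (1 / q)) ≤ Real.exp (D * 1) := by
          apply Real.exp_le_exp.2
          rw [mul_one, mul_one_div, div_le_iff₀ hq']
          exact_mod_cast (by rw [mul_comm]; exact hj)
      _ = Real.exp 1 ^ D := by rw [Real.exp_nat_mul]
      _ ≤ 4 ^ D := by
          gcongr
          have := Real.exp_one_lt_d9
          linarith
  have h3 : ((q : ℝ) + 1) ^ j ≤ 4 ^ D * q ^ j := by
    calc ((q : ℝ) + 1) ^ j ≤ (q * Real.exp (1 / q)) ^ j := by gcongr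
      _ = Real.exp (1 / q) ^ j * q ^ j := by rw [mul_pow, mul_comm]
      _ ≤ _ := by gcongr
  exact_mod_cast h3

/-- The number of columns among the first `j` in which the code word of `v` is zero. -/
def zeros (col : ℕ → ℕ → ℕ) (j v : ℕ) : ℕ := ((Finset.range j).filter fun l => col l v = 0).card

theorem zeros_succ (col : ℕ → ℕ → ℕ) (j v : ℕ) :
    zeros col (j + 1) v = zeros col j v + if col j v = 0 then 1 else 0 := by
  unfold zeros
  rw [Finset.range_add_one, Finset.filter_insert]
  split_ifs <;> simp

/-! ### From codes to robust union-free families -/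

/-- The sets `{l q + col l u | l < d}`, `u < n`. -/
def codeSet (n m q d : ℕ) (col : ℕ → ℕ → ℕ) (u : Fin n) : Finset (Fin m) :=
  Finset.univ.filter fun x => ∃ l < d, (x : ℕ) = l * q + col l u

theorem mul_add_inj {q l l' x x' : ℕ} (hx : x < q) (hx' : x' < q) (h : l * q + x = l' * q + x') :
    l = l' ∧ x = x' := by
  have hq : 0 < q := by omega
  have h1 : (l * q + x) / q = l := by
    rw [mul_comm, Nat.mul_add_div hq, Nat.div_eq_of_lt hx, add_zero]
  have h2 : (l' * q + x') / q = l' := by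
    rw [mul_comm, Nat.mul_add_div hq, Nat.div_eq_of_lt hx', add_zero]
  have h3 : l = l' := by rw [← h1, h, h2]
  subst h3
  exact ⟨rfl, by omega⟩

theorem map_codeSet {n q d : ℕ} {col : ℕ → ℕ → ℕ} (u : Fin n) (hlt : ∀ l < d, col l u < q) :
    (codeSet n (d * q) q d col u).map Fin.valEmbedding
      = (Finset.range d).image fun l => l * q + col l u := by
  ext y
  simp only [codeSet, Finset.mem_map, Finset.mem_filter, Finset.mem_univ, true_and,
    Fin.valEmbedding_apply, Finset.mem_image, Finset.mem_range]
  constructor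
  · rintro ⟨x, ⟨l, hl, hx⟩, rfl⟩
    exact ⟨l, hl, hx.symm⟩
  · rintro ⟨l, hl, rfl⟩
    have h1 := hlt l hl
    have h2 : (l + 1) * q ≤ d * q := Nat.mul_le_mul_right _ hl
    rw [add_mul] at h2
    exact ⟨⟨l * q + col l u, by omega⟩, ⟨l, hl, rfl⟩, rfl⟩

/-- A common point of two sets must lie in the same block `l` with the same letter, and by
additivity `col l i = col l j` makes `col l` vanish at `i ^^^ j ≠ 0`. So two sets share at most `Z`
points, and a union bound over `k` sets finishes. -/
theorem isRobustUFF_codeSet {n k D q d : ℕ} {col : ℕ → ℕ → ℕ} {α : ℝ} {Z : ℕ} (hn : n ≤ 2 ^ D)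
    (hlt : ∀ l < d, ∀ u < 2 ^ D, col l u < q)
    (hxor : ∀ l < d, ∀ u < 2 ^ D, ∀ v < 2 ^ D, col l (u ^^^ v) = col l u ^^^ col l v)
    (hZ : ∀ v, 1 ≤ v → v < 2 ^ D → zeros col d v ≤ Z) (hα : (k : ℝ) * Z < α * d) :
    IsRobustUFF (codeSet n (d * q) q d col) d k α := by
  have hcard : ∀ i, (codeSet n (d * q) q d col i).card = d := fun i => by
    have hi : ∀ l < d, col l i < q := fun l hl => hlt l hl i (by omega)
    rw [← Finset.card_map Fin.valEmbedding, map_codeSet i hi, Finset.card_image_of_injOn,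
      Finset.card_range]
    intro l hl l' hl' h
    exact (mul_add_inj (hi l (by simpa using hl)) (hi l' (by simpa using hl')) h).1
  have hpair : ∀ i j, i ≠ j →
      (codeSet n (d * q) q d col i ∩ codeSet n (d * q) q d col j).card ≤ Z := fun i j hij => by
    have hi : (i : ℕ) < 2 ^ D := by omega
    have hj : (j : ℕ) < 2 ^ D := by omega
    refine le_trans ?_ (hZ (i ^^^ j) ?_ (Nat.xor_lt_two_pow hi hj))
    · rw [← Finset.card_map Fin.valEmbedding]
      unfold zeros
      refine (Finset.card_le_card (t := ((Finset.range d).filter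
        fun l => col l (i ^^^ j) = 0).image fun l => l * q + col l i) ?_).trans
        Finset.card_image_le
      intro y hy
      simp only [codeSet, Finset.mem_map, Finset.mem_inter, Finset.mem_filter, Finset.mem_univ,
        true_and, Fin.valEmbedding_apply] at hy
      obtain ⟨x, ⟨⟨l, hl, hx⟩, ⟨l', hl', hx'⟩⟩, rfl⟩ := hy
      obtain ⟨rfl, he⟩ := mul_add_inj (hlt l hl i hi) (hlt l' hl' j hj) (hx.symm.trans hx')
      refine Finset.mem_image.2 ⟨l, ?_, hx.symm⟩
      rw [Finset.mem_filter, Finset.mem_range, hxor l hl _ hi _ hj, he]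
      exact ⟨hl, Nat.xor_self _⟩
    · rw [Nat.one_le_iff_ne_zero, Ne, Nat.xor_eq_zero_iff]
      exact fun h => hij (Fin.ext h)
  refine ⟨hcard, fun j hj => ?_⟩
  rw [hcard]
  refine lt_of_le_of_lt ?_ hα
  have : (codeSet n (d * q) q d col (j 0) ∩ Finset.univ.biUnion
      (fun i : Fin k => codeSet n (d * q) q d col (j i.succ))).card ≤ k * Z := by
    rw [Finset.inter_biUnion]
    refine Finset.card_biUnion_le.trans ?_
    refine (Finset.sum_le_card_nsmul _ _ Z fun i _ => hpair _ _ ?_).trans (by simp)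
    exact fun h => absurd (hj h) (Fin.succ_ne_zero i).symm
  exact_mod_cast this

/-! ### RAM subroutines that compute one column -/

namespace WordRAM

/-- A bound for the numbers that occur in the computation. -/
def cap (n q D : ℕ) : ℕ :=
  q * q + 2 * 2 ^ D + q + n * (q * D) + q * D + q * D * q + 2 * 2 ^ (3 * D) + 3

/-- The registers that the main part of the construction does not change. -/
structure Env (n q D : ℕ) (s : State) : Prop where
  r0 : s.reg 0 = n
  r4 : s.reg 4 = 0
  r5 : s.reg 5 = 1
  r6 : s.reg 6 = 2
  r8 : s.reg 8 = q
  r10 : s.reg 10 = q * q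
  r11 : s.reg 11 = 2 ^ D
  r13 : s.reg 13 = q * D
  -- Memory layout: the xor table fills `[0, q²)`; then come the current column and the weights (`2
  -- ^ D` cells each), the `q` buckets, and the output. `R₁₀`, `R₁₄`, `R₁₅`, `R₁₆` hold the start
  -- addresses of the last four.
  r14 : s.reg 14 = q * q + 2 ^ D
  r15 : s.reg 15 = q * q + 2 ^ D + 2 ^ D
  r16 : s.reg 16 = q * q + 2 ^ D + 2 ^ D + q

variable {B n q D : ℕ} {s s' : State}

theorem Env.frame {t : ℕ} (E : Env n q D s) (h : Frame t s s') (ht : 17 ≤ t) : Env n q D s' :=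
  ⟨(h 0 (by omega)).trans E.r0, (h 4 (by omega)).trans E.r4, (h 5 (by omega)).trans E.r5,
    (h 6 (by omega)).trans E.r6, (h 8 (by omega)).trans E.r8, (h 10 (by omega)).trans E.r10,
    (h 11 (by omega)).trans E.r11, (h 13 (by omega)).trans E.r13, (h 14 (by omega)).trans E.r14,
    (h 15 (by omega)).trans E.r15, (h 16 (by omega)).trans E.r16⟩

/-- Set the buckets to zero. -/
def clearBuckets : Program :=
  .seq (.const 20 0) (.loop 20 8
    (.seq (.arith .add 21 15 20) (.seq (.store 21 4) (.arith .add 20 20 5))))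

theorem run_clearBuckets (E : Env n q D s) (hB : cap n q D ≤ B) :
    Run B clearBuckets s (q * 4 + 2) fun s' => Frame 20 s s' ∧
      (∀ y < q, s'.mem (q * q + 2 ^ D + 2 ^ D + y) = 0) ∧
      ∀ p, p < q * q + 2 ^ D + 2 ^ D ∨ q * q + 2 ^ D + 2 ^ D + q ≤ p → s'.mem p = s.mem p := by
  unfold cap at hB
  refine Run.const_seq (by omega) ?_
  refine (Run.loop_const (fun x s' => s'.reg 20 = x ∧ Frame 20 s s' ∧
      (∀ y < x, s'.mem (q * q + 2 ^ D + 2 ^ D + y) = 0) ∧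
      ∀ p, p < q * q + 2 ^ D + 2 ^ D ∨ q * q + 2 ^ D + 2 ^ D + q ≤ p → s'.mem p = s.mem p)
      q 3 ?_ ?_ ?_).mono (by omega) fun s' h => h.2
  · rintro x s' ⟨h20, hF, -⟩
    rw [h20, (E.frame hF (by norm_num)).r8]
  · rintro x hx s' ⟨h20, hF, h1, h2⟩
    have E' := E.frame hF (by norm_num)
    refine Run.arith_seq (q * q + 2 ^ D + 2 ^ D + x) (by simp [Op.eval, E'.r15, h20]) (by omega) ?_
    refine Run.store_seq (q * q + 2 ^ D + 2 ^ D + x) 0 (by simp) (by simp [E'.r4]) ?_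
    refine Run.arith (x + 1) (by simp [Op.eval, E'.r5, h20]) (by omega) ?_
    refine ⟨by simp, ((hF.setReg (by norm_num)).setMem).setReg (by norm_num), fun y hy => ?_,
      fun p hp => ?_⟩
    · simp only [State.setReg_mem, State.setMem_mem]
      split_ifs with h
      · rfl
      · exact h1 y (by omega)
    · simp only [State.setReg_mem, State.setMem_mem]
      rw [if_neg (by omega), h2 p hp]
  · exact ⟨by simp, (Frame.refl 20 s).setReg (by norm_num), by simp, by simp⟩

/-- Add the weight of each `P + u`, where `P = R₁₈` and `u < P`, to the bucket of `u`. -/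
def fillBuckets : Program :=
  .seq (.const 20 0) (.loop 20 18
    (.seq (.arith .add 21 10 20) (.seq (.load 21 21) (.seq (.arith .add 21 21 15)
    (.seq (.arith .add 22 14 18) (.seq (.arith .add 22 22 20) (.seq (.load 22 22)
    (.seq (.load 23 21) (.seq (.arith .add 23 23 22) (.seq (.store 21 23)
    (.arith .add 20 20 5)))))))))))

theorem run_fillBuckets {P : ℕ} {A w : ℕ → ℕ} (E : Env n q D s) (hB : cap n q D ≤ B)
    (hP : s.reg 18 = P) (hPD : P + P ≤ 2 ^ D)
    (hA : ∀ u < P, s.mem (q * q + u) = A u) (hAq : ∀ u < P, A u < q)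
    (hw : ∀ v, v < 2 ^ D → s.mem (q * q + 2 ^ D + v) = w v)
    (hsum : ∑ u ∈ Finset.range P, w (P + u) ≤ B)
    (h0 : ∀ y < q, s.mem (q * q + 2 ^ D + 2 ^ D + y) = 0) :
    Run B fillBuckets s (P * 11 + 2) fun s' => Frame 20 s s' ∧
      (∀ y < q, s'.mem (q * q + 2 ^ D + 2 ^ D + y) = bucket A w P P y) ∧
      ∀ p, p < q * q + 2 ^ D + 2 ^ D ∨ q * q + 2 ^ D + 2 ^ D + q ≤ p → s'.mem p = s.mem p := by
  unfold cap at hB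
  refine Run.const_seq (by omega) ?_
  refine (Run.loop_const (fun x s' => s'.reg 20 = x ∧ Frame 20 s s' ∧
      (∀ y < q, s'.mem (q * q + 2 ^ D + 2 ^ D + y) = bucket A w P x y) ∧
      ∀ p, p < q * q + 2 ^ D + 2 ^ D ∨ q * q + 2 ^ D + 2 ^ D + q ≤ p → s'.mem p = s.mem p)
      P 10 ?_ ?_ ?_).mono (by omega) fun s' h => h.2
  · rintro x s' ⟨h20, hF, -⟩
    rw [h20, hF 18 (by norm_num), hP]
  · rintro x hx s' ⟨h20, hF, h1, h2⟩
    have E' := E.frame hF (by norm_num)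
    have h18 : s'.reg 18 = P := by rw [hF 18 (by norm_num), hP]
    have hAx := hAq x hx
    have hsucc : ∀ y, bucket A w P (x + 1) y
        = bucket A w P x y + if A x = y then w (P + x) else 0 := fun y => by
      rw [bucket, Finset.sum_range_succ, bucket]
    -- A partial bucket never exceeds the whole weight of the upper half, so the addition below
    -- respects the word bound.
    have hle := (bucket_le A w (P := P) (A x) (show x + 1 ≤ P by omega)).trans hsum
    rw [hsucc, if_pos rfl] at hle
    refine Run.arith_seq (q * q + x) (by simp [Op.eval, E'.r10, h20]) (by omega) ?_
    refine Run.load_seq (A x) (by simp [h2 (q * q + x) (by omega), hA x hx]) ?_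
    refine Run.arith_seq (q * q + 2 ^ D + 2 ^ D + A x)
      (by simp [Op.eval, E'.r15, add_comm]) (by omega) ?_
    refine Run.arith_seq (q * q + 2 ^ D + P) (by simp [Op.eval, E'.r14, h18]) (by omega) ?_
    refine Run.arith_seq (q * q + 2 ^ D + P + x) (by simp [Op.eval, h20]) (by omega) ?_
    refine Run.load_seq (w (P + x)) (by
      simp only [State.setReg_reg, State.setReg_mem, if_true]
      rw [h2 _ (by omega), add_assoc, hw _ (by omega)]) ?_
    refine Run.load_seq (bucket A w P x (A x)) (by simp [h1 _ hAx]) ?_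
    refine Run.arith_seq (bucket A w P x (A x) + w (P + x)) (by simp [Op.eval]) (by omega) ?_
    refine Run.store_seq (q * q + 2 ^ D + 2 ^ D + A x) (bucket A w P x (A x) + w (P + x))
      (by simp) (by simp) ?_
    refine Run.arith (x + 1) (by simp [Op.eval, E'.r5, h20]) (by omega) ?_
    refine ⟨by simp, ?_, fun y hy => ?_, fun p hp => ?_⟩
    · repeat first | exact hF | refine Frame.setReg ?_ (by norm_num) | refine Frame.setMem ?_
    · simp only [State.setReg_mem, State.setMem_mem]
      rw [hsucc]
      by_cases h : A x = y
      · subst h; simp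
      · rw [if_neg (by omega), if_neg h, h1 y hy, add_zero]
    · simp only [State.setReg_mem, State.setMem_mem]
      rw [if_neg (by omega), h2 p hp]
  · exact ⟨by simp, (Frame.refl 20 s).setReg (by norm_num), by simpa [bucket] using h0, by simp⟩

/-- Put the index of a smallest bucket into `R₁₉`. -/
def findMin : Program :=
  .seq (.const 19 0) (.seq (.load 22 15) (.seq (.const 20 0) (.loop 20 8
    (.seq (.arith .add 21 15 20) (.seq (.load 21 21)
    -- As `R₄ = 0`, adding `R₄` copies a register.
    (.seq (.ite 21 22 (.seq (.arith .add 22 21 4) (.arith .add 19 20 4)) .skip)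
    (.arith .add 20 20 5)))))))

theorem run_findMin {f : ℕ → ℕ} (E : Env n q D s) (hB : cap n q D ≤ B) (hq : 0 < q)
    (hf : ∀ y < q, s.mem (q * q + 2 ^ D + 2 ^ D + y) = f y) (hfB : ∀ y < q, f y ≤ B) :
    Run B findMin s (q * 7 + 4) fun s' => Frame 19 s s' ∧ s'.mem = s.mem ∧
      s'.reg 19 < q ∧ ∀ y < q, f (s'.reg 19) ≤ f y := by
  unfold cap at hB
  refine Run.const_seq (by omega) ?_
  refine Run.load_seq (f 0) (by simp [E.r15, ← hf 0 hq]) ?_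
  refine Run.const_seq (by omega) ?_
  refine (Run.loop_const (fun x s' => s'.reg 20 = x ∧ Frame 19 s s' ∧ s'.mem = s.mem ∧
      s'.reg 19 < q ∧ s'.reg 22 = f (s'.reg 19) ∧ ∀ y < x, f (s'.reg 19) ≤ f y)
      q 6 ?_ ?_ ?_).mono (by omega) fun s' h => ⟨h.2.1, h.2.2.1, h.2.2.2.1, h.2.2.2.2.2⟩
  · rintro x s' ⟨h20, hF, -⟩
    rw [h20, (E.frame hF (by norm_num)).r8]
  · rintro x hx s' ⟨h20, hF, hm, h19, h22, h1⟩
    have E' := E.frame hF (by norm_num)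
    refine Run.arith_seq (q * q + 2 ^ D + 2 ^ D + x) (by simp [Op.eval, E'.r15, h20]) (by omega) ?_
    refine Run.load_seq (f x) (by simp [hm, hf x hx]) ?_
    refine Run.mono (T := 3 + 1) (Run.seq (Run.ite (T := 2) (fun hc => ?_) fun hc => ?_))
      le_rfl fun _ h => h
    · simp only [State.setReg_reg, if_true] at hc
      norm_num at hc
      refine Run.arith_seq (f x) (by simp [Op.eval, E'.r4]) (hfB x hx) ?_
      refine Run.arith x (by simp [Op.eval, E'.r4, h20]) (by omega) ?_
      refine Run.arith (x + 1) (by simp [Op.eval, E'.r5, h20]) (by omega) ?_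
      refine ⟨by simp, ?_, by simp [hm], by simpa using hx, by simp, fun y hy => ?_⟩
      · repeat first | exact hF | refine Frame.setReg ?_ (by norm_num)
      · rcases Nat.lt_succ_iff_lt_or_eq.1 hy with h | rfl
        · have := h1 y h
          simp
          omega
        · simp
    · simp only [State.setReg_reg, if_true] at hc
      norm_num at hc
      refine Run.mono (T := 1) (Run.skip ?_) (by norm_num) fun _ h => h
      refine Run.arith (x + 1) (by simp [Op.eval, E'.r5, h20]) (by omega) ?_
      refine ⟨by simp, ?_, by simp [hm], by simpa using h19, by simpa using h22, fun y hy => ?_⟩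
      · repeat first | exact hF | refine Frame.setReg ?_ (by norm_num)
      · rcases Nat.lt_succ_iff_lt_or_eq.1 hy with h | rfl
        · simpa using h1 y h
        · simp
          omega
  · refine ⟨by simp, ?_, by simp, by simpa using hq, by simp, by simp⟩
    repeat first | exact Frame.refl _ _ | refine Frame.setReg ?_ (by norm_num)

/-- Extend the column from `[0, P)` to `[0, 2 P)`, with the value `R₁₉` at `P = R₁₈`. -/
def extend : Program :=
  .seq (.arith .mul 23 19 8) (.seq (.const 20 0) (.loop 20 18
    (.seq (.arith .add 21 10 20) (.seq (.load 22 21) (.seq (.arith .add 22 22 23)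
    (.seq (.load 22 22) (.seq (.arith .add 21 21 18) (.seq (.store 21 22)
    (.arith .add 20 20 5)))))))))

theorem run_extend {P x : ℕ} {A : ℕ → ℕ} (E : Env n q D s) (hB : cap n q D ≤ B)
    (hP : s.reg 18 = P) (hPD : P + P ≤ 2 ^ D) (hx : s.reg 19 = x) (hxq : x < q)
    (hA : ∀ u < P, s.mem (q * q + u) = A u) (hAq : ∀ u < P, A u < q)
    (htab : ∀ x < q, ∀ y < q, s.mem (x * q + y) = x ^^^ y) :
    Run B extend s (P * 8 + 3) fun s' => Frame 20 s s' ∧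
      (∀ u < P, s'.mem (q * q + (P + u)) = x ^^^ A u) ∧
      ∀ p, p < q * q + P ∨ q * q + (P + P) ≤ p → s'.mem p = s.mem p := by
  unfold cap at hB
  have hxle : x * q + q ≤ q * q := by
    rw [← Nat.succ_mul]; exact Nat.mul_le_mul_right _ hxq
  -- The start of row `x` of the xor table; adding `A u` to it gives the address of `x ^^^ A u`.
  refine Run.arith_seq (x * q) (by simp [Op.eval, E.r8, hx]) (by omega) ?_
  refine Run.const_seq (by omega) ?_
  refine (Run.loop_const (fun i s' => s'.reg 20 = i ∧ Frame 20 s s' ∧ s'.reg 23 = x * q ∧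
      (∀ u < i, s'.mem (q * q + (P + u)) = x ^^^ A u) ∧
      ∀ p, p < q * q + P ∨ q * q + (P + P) ≤ p → s'.mem p = s.mem p)
      P 7 ?_ ?_ ?_).mono (by omega) fun s' h => ⟨h.2.1, h.2.2.2⟩
  · rintro i s' ⟨h20, hF, -⟩
    rw [h20, hF 18 (by norm_num), hP]
  · rintro i hi s' ⟨h20, hF, h23, h1, h2⟩
    have E' := E.frame hF (by norm_num)
    have h18 : s'.reg 18 = P := by rw [hF 18 (by norm_num), hP]
    have hAi := hAq i hi
    refine Run.arith_seq (q * q + i) (by simp [Op.eval, E'.r10, h20]) (by omega) ?_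
    refine Run.load_seq (A i) (by simp [h2 (q * q + i) (by omega), hA i hi]) ?_
    refine Run.arith_seq (x * q + A i) (by simp [Op.eval, h23, add_comm]) (by omega) ?_
    refine Run.load_seq (x ^^^ A i)
      (by simp [h2 (x * q + A i) (by omega), htab x hxq _ hAi]) ?_
    refine Run.arith_seq (q * q + (P + i))
      (by simp only [Op.eval, State.setReg_reg]; simp [h18]; omega) (by omega) ?_
    refine Run.store_seq (q * q + (P + i)) (x ^^^ A i) (by simp) (by simp) ?_
    refine Run.arith (i + 1) (by simp [Op.eval, E'.r5, h20]) (by omega) ?_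
    refine ⟨by simp, ?_, by simp [h23], fun u hu => ?_, fun p hp => ?_⟩
    · repeat first | exact hF | refine Frame.setReg ?_ (by norm_num) | refine Frame.setMem ?_
    · simp only [State.setReg_mem, State.setMem_mem]
      by_cases h : u = i
      · subst h; simp
      · rw [if_neg (by omega), h1 u (by omega)]
    · simp only [State.setReg_mem, State.setMem_mem]
      rw [if_neg (by omega), h2 p hp]
  · refine ⟨by simp, ?_, by simp, by simp, by simp⟩
    repeat first | exact Frame.refl _ _ | refine Frame.setReg ?_ (by norm_num)

/-- Compute a column of the code. -/
def computeColumn : Program :=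
  .seq (.const 18 1) (.loop 18 11
    (.seq clearBuckets (.seq fillBuckets (.seq findMin (.seq extend (.arith .add 18 18 18))))))

theorem run_computeColumn {r : ℕ} {w : ℕ → ℕ} (E : Env n (2 ^ r) D s)
    (hB : cap n (2 ^ r) D ≤ B)
    (hw : ∀ v, v < 2 ^ D → s.mem (2 ^ r * 2 ^ r + 2 ^ D + v) = w v)
    (hsum : ∑ v ∈ Finset.Ico 1 (2 ^ D), w v ≤ B)
    (h0 : s.mem (2 ^ r * 2 ^ r) = 0)
    (htab : ∀ x < 2 ^ r, ∀ y < 2 ^ r, s.mem (x * 2 ^ r + y) = x ^^^ y) :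
    Run B computeColumn s (2 ^ r * D * 11 + 2 ^ D * 19 + D * 13 + 2) fun s' =>
      Frame 18 s s' ∧ IsColumn D (2 ^ r) (fun u => s'.mem (2 ^ r * 2 ^ r + u)) w ∧
      ∀ p, p < 2 ^ r * 2 ^ r ∨
        (2 ^ r * 2 ^ r + 2 ^ D ≤ p ∧ p < 2 ^ r * 2 ^ r + 2 ^ D + 2 ^ D) ∨
        2 ^ r * 2 ^ r + 2 ^ D + 2 ^ D + 2 ^ r ≤ p → s'.mem p = s.mem p := by
  have hq : 0 < 2 ^ r := by positivity
  have hB' := hB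
  unfold cap at hB'
  refine Run.mono (T := ∑ x ∈ Finset.range D, (2 ^ r * 11 + 2 ^ x * 19 + 12 + 1) + 1 + 1)
    (Run.const_seq (by omega) (Run.loop (fun i s' => Frame 18 s s' ∧ s'.reg 18 = 2 ^ i ∧
      IsColumn i (2 ^ r) (fun u => s'.mem (2 ^ r * 2 ^ r + u)) w ∧
      ∀ p, p < 2 ^ r * 2 ^ r ∨
        (2 ^ r * 2 ^ r + 2 ^ D ≤ p ∧ p < 2 ^ r * 2 ^ r + 2 ^ D + 2 ^ D) ∨
        2 ^ r * 2 ^ r + 2 ^ D + 2 ^ D + 2 ^ r ≤ p → s'.mem p = s.mem p)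
      D (fun i => 2 ^ r * 11 + 2 ^ i * 19 + 12) ?_ ?_ ?_)) ?_ fun s' h => ⟨h.1, h.2.2⟩
  · rintro i s' ⟨hF, h18, -⟩
    rw [h18, (E.frame hF (by norm_num)).r11]
    exact Nat.pow_lt_pow_iff_right (by norm_num)
  · rintro i hi s₁ ⟨hF₁, h18, hcol, hm₁⟩
    have E₁ := E.frame hF₁ (by norm_num)
    have hPD : 2 ^ i + 2 ^ i ≤ 2 ^ D := by
      rw [← mul_two, ← pow_succ]
      exact Nat.pow_le_pow_right (by norm_num) hi
    have hsum' : ∑ u ∈ Finset.range (2 ^ i), w (2 ^ i + u) ≤ B := by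
      refine le_trans ?_ hsum
      have h1 := sum_Ico_two_pow_succ i w
      have h2 : ∑ v ∈ Finset.Ico 1 (2 ^ (i + 1)), w v ≤ ∑ v ∈ Finset.Ico 1 (2 ^ D), w v :=
        Finset.sum_le_sum_of_subset (Finset.Ico_subset_Ico_right (by rw [pow_succ]; omega))
      omega
    set A : ℕ → ℕ := fun u => s₁.mem (2 ^ r * 2 ^ r + u) with hA
    refine Run.mono (T := (2 ^ r * 4 + 2) + ((2 ^ i * 11 + 2) + ((2 ^ r * 7 + 4) +
      ((2 ^ i * 8 + 3) + 1)))) (Run.seq ((run_clearBuckets E₁ hB).mono le_rfl ?_)) (by omega)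
      fun _ h => h
    rintro s₂ ⟨hF₂, hz₂, hm₂⟩
    have E₂ := E₁.frame hF₂ (by norm_num)
    refine Run.seq ((run_fillBuckets (P := 2 ^ i) (A := A) (w := w) E₂ hB
      (by rw [hF₂ 18 (by norm_num), h18]) hPD (fun u hu => hm₂ _ (by omega)) hcol.lt
      (fun v hv => by rw [hm₂ _ (by omega), hm₁ _ (by omega), hw v hv]) hsum' hz₂).mono le_rfl ?_)
    rintro s₃ ⟨hF₃, hb₃, hm₃⟩
    have E₃ := E₂.frame hF₃ (by norm_num)
    refine Run.seq ((run_findMin E₃ hB hq hb₃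
      fun y _ => (bucket_le A w y le_rfl).trans hsum').mono le_rfl ?_)
    rintro s₄ ⟨hF₄, hm₄, hx, hmin⟩
    have E₄ := E₃.frame hF₄ (by norm_num)
    have h18' : s₄.reg 18 = 2 ^ i := by
      rw [hF₄ 18 (by norm_num), hF₃ 18 (by norm_num), hF₂ 18 (by norm_num), h18]
    have htab' : ∀ x < 2 ^ r, ∀ y < 2 ^ r, s₄.mem (x * 2 ^ r + y) = x ^^^ y := fun x hx y hy => by
      have hxle : x * 2 ^ r + 2 ^ r ≤ 2 ^ r * 2 ^ r := by
        rw [← Nat.succ_mul]; exact Nat.mul_le_mul_right _ hx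
      rw [hm₄, hm₃ _ (by omega), hm₂ _ (by omega), hm₁ _ (by omega), htab x hx y hy]
    refine Run.seq ((run_extend (P := 2 ^ i) (A := A) E₄ hB h18' hPD rfl hx
      (fun u hu => by rw [hm₄, hm₃ _ (by omega), hm₂ _ (by omega)]) hcol.lt htab').mono le_rfl ?_)
    rintro s₅ ⟨hF₅, hnew, hm₅⟩
    have h18'' : s₅.reg 18 = 2 ^ i := by rw [hF₅ 18 (by norm_num), h18']
    refine Run.arith (2 ^ (i + 1)) (by simp [Op.eval, h18'', pow_succ, mul_two])
      (by rw [pow_succ]; omega) ?_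
    refine ⟨?_, by simp, ?_, fun p hp => ?_⟩
    · exact ((((hF₁.trans hF₂ (by norm_num)).trans hF₃ (by norm_num)).trans hF₄
        (by norm_num)).trans hF₅ (by norm_num)).setReg (by norm_num)
    · refine hcol.succ hx hmin (fun u hu => ?_) hnew
      simp only [State.setReg_mem]
      rw [hm₅ _ (by omega), hm₄, hm₃ _ (by omega), hm₂ _ (by omega)]
    · simp only [State.setReg_mem]
      rw [hm₅ _ (by omega), hm₄, hm₃ _ (by omega), hm₂ _ (by omega), hm₁ _ (by omega)]
  -- For `i = 0` the domain is `{0}`: both weight sums are empty, and the only value is `0` by `h0`.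
  · refine ⟨(Frame.refl _ _).setReg (by norm_num), by simp, ⟨?_, ?_, by simp⟩, by simp⟩
    · intro u hu
      obtain rfl : u = 0 := by omega
      simp [h0]
    · intro u hu v hv
      obtain rfl : u = 0 := by omega
      obtain rfl : v = 0 := by omega
      simp [h0]
  -- The costs `2 ^ x` form a geometric series, so the `D` rounds together cost only `O(2 ^ D +
  -- qD)`.
  · have h1 : ∑ x ∈ Finset.range D, 2 ^ x ≤ 2 ^ D := by
      rw [Nat.geomSum_eq le_rfl]
      simp
    have h2 : ∑ x ∈ Finset.range D, (2 ^ r * 11 + 2 ^ x * 19 + 12 + 1)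
        = 2 ^ r * D * 11 + (∑ x ∈ Finset.range D, 2 ^ x) * 19 + D * 13 := by
      simp only [Finset.sum_add_distrib, Finset.sum_const, Finset.card_range, Finset.sum_mul,
        smul_eq_mul]
      ring
    rw [h2]
    omega

end WordRAM

/-! ### Weights, output, and the sequence of all columns -/

theorem zeros_update (col : ℕ → ℕ → ℕ) (A : ℕ → ℕ) (j v : ℕ) :
    zeros (Function.update col j A) (j + 1) v = zeros col j v + if A v = 0 then 1 else 0 := by
  rw [zeros_succ, Function.update_self]
  congr 1
  unfold zeros
  congr 1
  refine Finset.filter_congr fun l hl => ?_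
  rw [Function.update_of_ne (Finset.mem_range.1 hl).ne]

/-- The machine has no bitwise instruction; this recursion lets `writeTable` obtain each xor from an
earlier entry of the table. -/
theorem Nat.xor_eq_two_mul_add (x y : ℕ) : x ^^^ y = 2 * (x / 2 ^^^ y / 2) + (x + y) % 2 := by
  rw [← Nat.xor_div_two, ← Nat.xor_mod_two_eq, Nat.div_add_mod]

namespace WordRAM

variable {B n q D : ℕ} {s s' : State}

/-- Double the weights of the zeros of the current column. -/
def updateWeights : Program :=
  .seq (.const 20 1) (.loop 20 11
    (.seq (.arith .add 21 10 20) (.seq (.load 21 21)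
    -- As `R₅ = 1`, the test `R₂₁ < R₅` asks whether the column vanishes.
    (.seq (.ite 21 5 (.seq (.arith .add 22 14 20) (.seq (.load 23 22)
      (.seq (.arith .add 23 23 23) (.store 22 23)))) .skip)
    (.arith .add 20 20 5)))))

theorem run_updateWeights {A w : ℕ → ℕ} (E : Env n q D s) (hB : cap n q D ≤ B)
    (hA : ∀ u < 2 ^ D, s.mem (q * q + u) = A u)
    (hw : ∀ v, v < 2 ^ D → s.mem (q * q + 2 ^ D + v) = w v)
    (hwB : ∀ v, 1 ≤ v → v < 2 ^ D → w v + w v ≤ B) :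
    Run B updateWeights s (2 ^ D * 9 + 2) fun s' => Frame 20 s s' ∧
      (∀ v, 1 ≤ v → v < 2 ^ D →
        s'.mem (q * q + 2 ^ D + v) = if A v = 0 then w v + w v else w v) ∧
      ∀ p, p < q * q + 2 ^ D ∨ q * q + 2 ^ D + 2 ^ D ≤ p → s'.mem p = s.mem p := by
  unfold cap at hB
  have hD : 0 < 2 ^ D := by positivity
  refine Run.const_seq (by omega) ?_
  -- The counter starts at `1`: the word of `0` vanishes in every column, and its weight would
  -- double each time and exceed every useful bound.
  refine (Run.loop_const (fun x s' => s'.reg 20 = x + 1 ∧ Frame 20 s s' ∧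
      (∀ v, 1 ≤ v → v < x + 1 →
        s'.mem (q * q + 2 ^ D + v) = if A v = 0 then w v + w v else w v) ∧
      ∀ p, p < q * q + 2 ^ D ∨ q * q + 2 ^ D + (x + 1) ≤ p → s'.mem p = s.mem p)
      (2 ^ D - 1) 8 ?_ ?_ ?_).mono (by omega) fun s' h => ?_
  · rintro x s' ⟨h20, hF, -⟩
    rw [h20, (E.frame hF (by norm_num)).r11]
    omega
  · rintro x hx s' ⟨h20, hF, h1, h2⟩
    have E' := E.frame hF (by norm_num)
    refine Run.arith_seq (q * q + (x + 1)) (by simp [Op.eval, E'.r10, h20]) (by omega) ?_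
    refine Run.load_seq (A (x + 1))
      (by simp [h2 (q * q + (x + 1)) (by omega), hA (x + 1) (by omega)]) ?_
    refine Run.mono (T := 5 + 1) (Run.seq (Run.ite (T := 4) (fun hc => ?_) fun hc => ?_))
      le_rfl fun _ h => h
    · simp only [State.setReg_reg] at hc
      norm_num [E'.r5] at hc
      refine Run.arith_seq (q * q + 2 ^ D + (x + 1)) (by simp [Op.eval, E'.r14, h20])
        (by omega) ?_
      refine Run.load_seq (w (x + 1)) (by
        simp only [State.setReg_reg, State.setReg_mem, if_true]
        rw [h2 _ (by omega), hw _ (by omega)]) ?_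
      refine Run.arith_seq (w (x + 1) + w (x + 1)) (by simp [Op.eval])
        (hwB _ (by omega) (by omega)) ?_
      refine Run.store (q * q + 2 ^ D + (x + 1)) (w (x + 1) + w (x + 1)) (by simp) (by simp) ?_
      refine Run.arith (x + 1 + 1) (by simp [Op.eval, E'.r5, h20]) (by omega) ?_
      refine ⟨by simp, ?_, fun v hv hv' => ?_, fun p hp => ?_⟩
      · repeat first | exact hF | refine Frame.setReg ?_ (by norm_num) | refine Frame.setMem ?_
      · simp only [State.setReg_mem, State.setMem_mem]
        by_cases h : v = x + 1
        · subst h; simp [hc]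
        · rw [if_neg (by omega), h1 v hv (by omega)]
      · simp only [State.setReg_mem, State.setMem_mem]
        rw [if_neg (by omega), h2 p (by omega)]
    · simp only [State.setReg_reg] at hc
      norm_num [E'.r5] at hc
      refine Run.mono (T := 1) (Run.skip ?_) (by norm_num) fun _ h => h
      refine Run.arith (x + 1 + 1) (by simp [Op.eval, E'.r5, h20]) (by omega) ?_
      refine ⟨by simp, ?_, fun v hv hv' => ?_, fun p hp => ?_⟩
      · repeat first | exact hF | refine Frame.setReg ?_ (by norm_num)
      · simp only [State.setReg_mem]
        by_cases h : v = x + 1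
        · subst h; rw [if_neg (by omega), h2 _ (by omega), hw _ (by omega)]
        · rw [h1 v hv (by omega)]
      · simp only [State.setReg_mem]
        rw [h2 p (by omega)]
  · exact ⟨by simp, (Frame.refl 20 s).setReg (by norm_num), fun v _ _ => by omega, by simp⟩
  · exact ⟨h.2.1, fun v hv hv' => h.2.2.1 v hv (by omega), fun p hp => h.2.2.2 p (by omega)⟩

/-- Write the elements of all sets that come from column number `R₁₇`. -/
def writeColumn : Program :=
  .seq (.arith .mul 22 17 8) (.seq (.arith .add 23 16 17) (.seq (.const 20 0) (.loop 20 0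
    (.seq (.arith .add 21 10 20) (.seq (.load 21 21) (.seq (.arith .add 21 21 22)
    (.seq (.store 23 21) (.seq (.arith .add 23 23 13) (.arith .add 20 20 5)))))))))

theorem run_writeColumn {A : ℕ → ℕ} {j : ℕ} (E : Env n q D s) (hB : cap n q D ≤ B)
    (hn : n ≤ 2 ^ D) (hj : s.reg 17 = j) (hjd : j < q * D)
    (hA : ∀ u < 2 ^ D, s.mem (q * q + u) = A u) (hAq : ∀ u < 2 ^ D, A u < q) :
    Run B writeColumn s (n * 7 + 4) fun s' => Frame 20 s s' ∧
      (∀ u < n, s'.mem (q * q + 2 ^ D + 2 ^ D + q + u * (q * D) + j) = j * q + A u) ∧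
      ∀ p, (∀ u < n, p ≠ q * q + 2 ^ D + 2 ^ D + q + u * (q * D) + j) → s'.mem p = s.mem p := by
  unfold cap at hB
  have hjq : j * q + q ≤ q * D * q := by
    rw [← Nat.succ_mul]; exact Nat.mul_le_mul_right _ hjd
  refine Run.arith_seq (j * q) (by simp [Op.eval, E.r8, hj]) (by omega) ?_
  refine Run.arith_seq (q * q + 2 ^ D + 2 ^ D + q + j) (by simp [Op.eval, E.r16, hj]) (by omega) ?_
  refine Run.const_seq (by omega) ?_
  refine (Run.loop_const (fun x s' => s'.reg 20 = x ∧ Frame 20 s s' ∧ s'.reg 22 = j * q ∧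
      s'.reg 23 = q * q + 2 ^ D + 2 ^ D + q + x * (q * D) + j ∧
      (∀ u < x, s'.mem (q * q + 2 ^ D + 2 ^ D + q + u * (q * D) + j) = j * q + A u) ∧
      ∀ p, (∀ u < x, p ≠ q * q + 2 ^ D + 2 ^ D + q + u * (q * D) + j) → s'.mem p = s.mem p)
      n 6 ?_ ?_ ?_).mono (by omega) fun s' h => ⟨h.2.1, h.2.2.2.2⟩
  · rintro x s' ⟨h20, hF, -⟩
    rw [h20, (E.frame hF (by norm_num)).r0]
  · rintro x hx s' ⟨h20, hF, h22, h23, h1, h2⟩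
    have E' := E.frame hF (by norm_num)
    have hAx := hAq x (by omega)
    have hxd : x * (q * D) + q * D ≤ n * (q * D) := by
      rw [← Nat.succ_mul]; exact Nat.mul_le_mul_right _ hx
    refine Run.arith_seq (q * q + x) (by simp [Op.eval, E'.r10, h20]) (by omega) ?_
    refine Run.load_seq (A x)
      (by simp [h2 (q * q + x) (fun u _ => by omega), hA x (by omega)]) ?_
    refine Run.arith_seq (j * q + A x) (by simp [Op.eval, h22, add_comm]) (by omega) ?_
    refine Run.store_seq (q * q + 2 ^ D + 2 ^ D + q + x * (q * D) + j) (j * q + A x)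
      (by simp [h23]) (by simp) ?_
    refine Run.arith_seq (q * q + 2 ^ D + 2 ^ D + q + (x + 1) * (q * D) + j)
      (by simp [Op.eval, h23, E'.r13]; ring) (by rw [Nat.succ_mul]; omega) ?_
    refine Run.arith (x + 1) (by simp [Op.eval, E'.r5, h20]) (by omega) ?_
    refine ⟨by simp, ?_, by simp [h22], by simp, fun u hu => ?_, fun p hp => ?_⟩
    · repeat first | exact hF | refine Frame.setReg ?_ (by norm_num) | refine Frame.setMem ?_
    · simp only [State.setReg_mem, State.setMem_mem]
      by_cases h : u = x
      · subst h; simp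
      · have hux : u * (q * D) + q * D ≤ x * (q * D) := by
          rw [← Nat.succ_mul]; exact Nat.mul_le_mul_right _ (by omega)
        rw [if_neg (by omega), h1 u (by omega)]
    · simp only [State.setReg_mem, State.setMem_mem]
      rw [if_neg (hp x (by omega)), h2 p fun u hu => hp u (by omega)]
  · refine ⟨by simp, ?_, by simp, by simp, by simp, by simp⟩
    repeat first | exact Frame.refl _ _ | refine Frame.setReg ?_ (by norm_num)

/-- Compute and write all columns. -/
def writeCode : Program :=
  .seq (.const 17 0) (.loop 17 13
    (.seq computeColumn (.seq updateWeights (.seq writeColumn (.arith .add 17 17 5)))))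

/-- The hypothesis is the potential bound `Φ < 2 ^ D (1 + 1/q) ^ j` without fractions. The
conclusion serves twice: it bounds the numbers during the computation, and at the end it bounds the
zeros of each word. -/
theorem sum_lt_of_mul_lt {Φ j : ℕ} (hq : 0 < q) (hj : j ≤ q * D)
    (h : Φ * q ^ j < 2 ^ D * (q + 1) ^ j) : Φ < 2 ^ (3 * D) := by
  have h1 := succ_pow_le_four_pow_mul hq hj
  have h2 : Φ * q ^ j < 2 ^ (3 * D) * q ^ j := by
    refine h.trans_le ((Nat.mul_le_mul_left _ h1).trans (le_of_eq ?_))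
    rw [← mul_assoc, show (4 : ℕ) = 2 ^ 2 by norm_num, ← pow_mul, ← pow_add]
    congr 2
    omega
  exact Nat.lt_of_mul_lt_mul_right h2

theorem run_writeCode {r : ℕ} (E : Env n (2 ^ r) D s) (hB : cap n (2 ^ r) D ≤ B) (hn : n ≤ 2 ^ D)
    (h0 : s.mem (2 ^ r * 2 ^ r) = 0)
    (hw : ∀ v, v < 2 ^ D → s.mem (2 ^ r * 2 ^ r + 2 ^ D + v) = 1)
    (htab : ∀ x < 2 ^ r, ∀ y < 2 ^ r, s.mem (x * 2 ^ r + y) = x ^^^ y) :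
    Run B writeCode s
      (2 ^ r * D * (2 ^ r * D * 11 + 2 ^ D * 28 + D * 13 + n * 7 + 10) + 2) fun s' =>
      Frame 17 s s' ∧ ∃ col : ℕ → ℕ → ℕ,
        (∀ l < 2 ^ r * D, ∀ u < 2 ^ D, col l u < 2 ^ r) ∧
        (∀ l < 2 ^ r * D, ∀ u < 2 ^ D, ∀ v < 2 ^ D, col l (u ^^^ v) = col l u ^^^ col l v) ∧
        (∀ v, 1 ≤ v → v < 2 ^ D → zeros col (2 ^ r * D) v ≤ 3 * D - 1) ∧
        ∀ u < n, ∀ l < 2 ^ r * D,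
          s'.mem (2 ^ r * 2 ^ r + 2 ^ D + 2 ^ D + 2 ^ r + u * (2 ^ r * D) + l)
            = l * 2 ^ r + col l u := by
  have hq : 0 < 2 ^ r := by positivity
  have hD : 0 < 2 ^ D := by positivity
  have hB' := hB
  unfold cap at hB'
  refine Run.const_seq (by omega) ?_
  refine (Run.loop_const (fun j s' => j ≤ 2 ^ r * D ∧ s'.reg 17 = j ∧ Frame 17 s s' ∧
      s'.mem (2 ^ r * 2 ^ r) = 0 ∧
      (∀ x < 2 ^ r, ∀ y < 2 ^ r, s'.mem (x * 2 ^ r + y) = x ^^^ y) ∧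
      -- The potential: each column multiplies the total weight by at most `(q + 1) / q`.
      (∑ v ∈ Finset.Ico 1 (2 ^ D), s'.mem (2 ^ r * 2 ^ r + 2 ^ D + v)) * (2 ^ r) ^ j
        < 2 ^ D * (2 ^ r + 1) ^ j ∧
      ∃ col : ℕ → ℕ → ℕ,
        (∀ l < j, ∀ u < 2 ^ D, col l u < 2 ^ r) ∧
        (∀ l < j, ∀ u < 2 ^ D, ∀ v < 2 ^ D, col l (u ^^^ v) = col l u ^^^ col l v) ∧
        (∀ v, 1 ≤ v → v < 2 ^ D →
          s'.mem (2 ^ r * 2 ^ r + 2 ^ D + v) = 2 ^ zeros col j v) ∧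
        ∀ u < n, ∀ l < j, s'.mem (2 ^ r * 2 ^ r + 2 ^ D + 2 ^ D + 2 ^ r + u * (2 ^ r * D) + l)
            = l * 2 ^ r + col l u)
      (2 ^ r * D) (2 ^ r * D * 11 + 2 ^ D * 28 + D * 13 + n * 7 + 9) ?_ ?_ ?_).mono le_rfl ?_
  · rintro x s' ⟨-, h17, hF, -⟩
    rw [h17, (E.frame hF (by norm_num)).r13]
  · rintro j hj s₁ ⟨-, h17, hF₁, hz, htab₁, hsum, col, hlt, hxor, hwt, hout⟩
    have E₁ := E.frame hF₁ (by norm_num)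
    have hsum' := sum_lt_of_mul_lt hq hj.le hsum
    set w : ℕ → ℕ := fun v => s₁.mem (2 ^ r * 2 ^ r + 2 ^ D + v) with hw
    replace hsum' : ∑ v ∈ Finset.Ico 1 (2 ^ D), w v < 2 ^ (3 * D) := hsum'
    refine Run.mono (T := (2 ^ r * D * 11 + 2 ^ D * 19 + D * 13 + 2) + ((2 ^ D * 9 + 2) +
      ((n * 7 + 4) + 1))) (Run.seq ((run_computeColumn (w := w) E₁ hB (fun _ _ => rfl) (by omega)
      hz htab₁).mono le_rfl ?_)) (by omega) fun _ h => h
    rintro s₂ ⟨hF₂, hcol, hm₂⟩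
    have E₂ := E₁.frame hF₂ (by norm_num)
    set A : ℕ → ℕ := fun u => s₂.mem (2 ^ r * 2 ^ r + u) with hA
    refine Run.seq ((run_updateWeights (A := A) (w := w) E₂ hB (fun _ _ => rfl)
      (fun v hv => hm₂ _ (by omega)) fun v hv hv' => ?_).mono le_rfl ?_)
    -- A single weight is below `2 ^ (3D)`, so doubling it stays within the term `2 * 2 ^ (3 * D)`
    -- of `cap`.
    · have := Finset.single_le_sum (f := w) (fun _ _ => Nat.zero_le _) (Finset.mem_Ico.2 ⟨hv, hv'⟩)
      omega
    rintro s₃ ⟨hF₃, hw₃, hm₃⟩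
    have E₃ := E₂.frame hF₃ (by norm_num)
    have h17₃ : s₃.reg 17 = j := by rw [hF₃ 17 (by norm_num), hF₂ 17 (by norm_num), h17]
    refine Run.seq ((run_writeColumn (A := A) (j := j) E₃ hB hn
      h17₃ hj (fun u hu => hm₃ _ (by omega))
      hcol.lt).mono le_rfl ?_)
    rintro s₄ ⟨hF₄, hout₄, hm₄⟩
    have E₄ := E₃.frame hF₄ (by norm_num)
    have hlow : ∀ p, p < 2 ^ r * 2 ^ r + 2 ^ D + 2 ^ D → s₄.mem p = s₃.mem p :=
      fun p hp => hm₄ p fun u _ => by omega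
    refine Run.arith (j + 1) (by simp [Op.eval, E₄.r5, hF₄ 17 (by norm_num), h17₃]) (by omega) ?_
    refine ⟨by omega, by simp, ?_, ?_, fun x hx y hy => ?_, ?_, Function.update col j A,
      fun l hl => ?_, fun l hl => ?_, fun v hv hv' => ?_, fun u hu l hl => ?_⟩
    · exact (((hF₁.trans hF₂ (by norm_num)).trans hF₃ (by norm_num)).trans hF₄
        (by norm_num)).setReg (by norm_num)
    · simp only [State.setReg_mem]
      rw [hlow _ (by omega), hm₃ _ (by omega)]
      exact hcol.zero
    · have hxle : x * 2 ^ r + 2 ^ r ≤ 2 ^ r * 2 ^ r := by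
        rw [← Nat.succ_mul]; exact Nat.mul_le_mul_right _ hx
      simp only [State.setReg_mem]
      rw [hlow _ (by omega), hm₃ _ (by omega), hm₂ _ (by omega), htab₁ x hx y hy]
    · have e : ∑ v ∈ Finset.Ico 1 (2 ^ D), s₄.mem (2 ^ r * 2 ^ r + 2 ^ D + v)
          = ∑ v ∈ Finset.Ico 1 (2 ^ D), w v
            + ∑ v ∈ Finset.Ico 1 (2 ^ D), if A v = 0 then w v else 0 := by
        rw [← Finset.sum_add_distrib]
        refine Finset.sum_congr rfl fun v hv => ?_
        rw [Finset.mem_Ico] at hv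
        rw [hlow _ (by omega), hw₃ v hv.1 hv.2]
        split_ifs <;> simp
      simp only [State.setReg_mem]
      rw [e]
      -- The zeros of the new column are counted twice in the new total, and `light` bounds `q`
      -- times their weight by the old total.
      calc _ = (2 ^ r * ∑ v ∈ Finset.Ico 1 (2 ^ D), w v
            + 2 ^ r * ∑ v ∈ Finset.Ico 1 (2 ^ D), if A v = 0 then w v else 0) * (2 ^ r) ^ j := by
            ring
        _ ≤ (2 ^ r * ∑ v ∈ Finset.Ico 1 (2 ^ D), w v
            + ∑ v ∈ Finset.Ico 1 (2 ^ D), w v) * (2 ^ r) ^ j := by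
            gcongr
            exact hcol.light
        _ = (2 ^ r + 1) * ((∑ v ∈ Finset.Ico 1 (2 ^ D), w v) * (2 ^ r) ^ j) := by ring
        _ < (2 ^ r + 1) * (2 ^ D * (2 ^ r + 1) ^ j) := by gcongr
        _ = _ := by ring
    · rcases Nat.lt_succ_iff_lt_or_eq.1 hl with h | rfl
      · rw [Function.update_of_ne h.ne]; exact hlt l h
      · rw [Function.update_self]; exact hcol.lt
    · rcases Nat.lt_succ_iff_lt_or_eq.1 hl with h | rfl
      · rw [Function.update_of_ne h.ne]; exact hxor l h
      · rw [Function.update_self]; exact hcol.xor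
    · simp only [State.setReg_mem]
      rw [hlow _ (by omega), hw₃ v hv hv', zeros_update, hw]
      simp only []
      rw [hwt v hv hv']
      split_ifs
      · rw [pow_succ, mul_two]
      · rw [add_zero]
    · simp only [State.setReg_mem]
      rcases Nat.lt_succ_iff_lt_or_eq.1 hl with h | rfl
      · rw [Function.update_of_ne h.ne, hm₄ _ fun u' _ h' => ?_, hm₃ _ (by omega),
          hm₂ _ (by omega), hout u hu l h]
        -- Column `j` does not overwrite earlier output: equal addresses would force `l = j`, but `l
        -- < j`.
        have := (mul_add_inj (q := 2 ^ r * D) (l := u) (l' := u') (x := l) (x' := j) (by omega) hj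
          (by omega)).2
        omega
      · rw [Function.update_self, hout₄ u hu]
  · refine ⟨Nat.zero_le _, by simp, (Frame.refl _ _).setReg (by norm_num), h0, htab, ?_,
      fun _ _ => 0, by simp, by simp, fun v hv hv' => ?_, by simp⟩
    · simp only [State.setReg_mem]
      -- All weights are `1`, so the initial total is `2 ^ D - 1 < 2 ^ D`.
      rw [Finset.sum_congr rfl fun v hv => hw v (Finset.mem_Ico.1 hv).2]
      simp
    · simp [hw v hv', zeros]
  · rintro s' ⟨-, -, hF, -, -, hsum, col, hlt, hxor, hwt, hout⟩
    refine ⟨hF, col, hlt, hxor, fun v hv hv' => ?_, hout⟩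
    have h1 := sum_lt_of_mul_lt hq le_rfl hsum
    have h2 := Finset.single_le_sum (f := fun v => s'.mem (2 ^ r * 2 ^ r + 2 ^ D + v))
      (fun _ _ => Nat.zero_le _) (Finset.mem_Ico.2 ⟨hv, hv'⟩)
    simp only [hwt v hv hv'] at h2
    -- Each weight is at most the total, so `2 ^ zeros < 2 ^ (3D)`. The strict inequality gives `3D
    -- - 1`, which makes the final comparison with `α d` strict.
    have h3 := (Nat.pow_lt_pow_iff_right (by norm_num)).1 (h2.trans_lt h1)
    omega

/-! ### Initialization: the xor table and the weights -/

/-- Write the table of the bitwise sums of the numbers below `q` to the addresses below `q ^ 2`. -/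
def writeTable : Program :=
  .seq (.const 20 0) (.loop 20 10
    (.seq (.arith .div 21 20 8) (.seq (.arith .mod 22 20 8) (.seq (.arith .add 23 21 22)
    (.seq (.arith .mod 23 23 6) (.seq (.arith .div 21 21 6) (.seq (.arith .div 22 22 6)
    (.seq (.arith .mul 21 21 8) (.seq (.arith .add 21 21 22) (.seq (.load 21 21)
    (.seq (.arith .add 21 21 21) (.seq (.arith .add 21 21 23) (.seq (.store 20 21)
    (.arith .add 20 20 5))))))))))))))

theorem run_writeTable {r : ℕ} (E : Env n (2 ^ r) D s) (hB : cap n (2 ^ r) D ≤ B)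
    (h0 : s.mem 0 = 0) :
    Run B writeTable s (2 ^ r * 2 ^ r * 14 + 2) fun s' => Frame 20 s s' ∧
      (∀ x < 2 ^ r, ∀ y < 2 ^ r, s'.mem (x * 2 ^ r + y) = x ^^^ y) ∧
      ∀ p, 2 ^ r * 2 ^ r ≤ p → s'.mem p = s.mem p := by
  have hq : 0 < 2 ^ r := by positivity
  unfold cap at hB
  refine Run.const_seq (by omega) ?_
  refine (Run.loop_const (fun z s' => s'.reg 20 = z ∧ Frame 20 s s' ∧ s'.mem 0 = 0 ∧
      (∀ p < z, s'.mem p = (p / 2 ^ r) ^^^ (p % 2 ^ r)) ∧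
      ∀ p, 2 ^ r * 2 ^ r ≤ p → s'.mem p = s.mem p)
      (2 ^ r * 2 ^ r) 13 ?_ ?_ ?_).mono (by omega) fun s' h => ⟨h.2.1, fun x hx y hy => ?_,
        h.2.2.2.2⟩
  · rintro z s' ⟨h20, hF, -⟩
    rw [h20, (E.frame hF (by norm_num)).r10]
  · rintro z hz s' ⟨h20, hF, hz0, h1, h2⟩
    have E' := E.frame hF (by norm_num)
    have hy : z % 2 ^ r < 2 ^ r := Nat.mod_lt _ hq
    have hx : z / 2 ^ r < 2 ^ r := Nat.div_lt_of_lt_mul hz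
    have hzxy : z / 2 ^ r * 2 ^ r + z % 2 ^ r = z := by rw [mul_comm]; exact Nat.div_add_mod _ _
    have hlt := Nat.xor_lt_two_pow hx hy
    have hxor := Nat.xor_eq_two_mul_add (z / 2 ^ r) (z % 2 ^ r)
    set x := z / 2 ^ r with hxdef
    set y := z % 2 ^ r with hydef
    have hx2 : x / 2 * 2 ^ r ≤ x * 2 ^ r := Nat.mul_le_mul_right _ (Nat.div_le_self _ _)
    -- The entry for `(x / 2, y / 2)` lies strictly before `z`, except for `z = 0`, which reads the
    -- very cell that it is about to fill. This is why the invariant keeps cell `0` at `0`.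
    have hload : s'.mem (x / 2 * 2 ^ r + y / 2) = x / 2 ^^^ y / 2 := by
      rcases Nat.eq_zero_or_pos z with h | h
      · have hx0 : x = 0 := by rw [hxdef, h, Nat.zero_div]
        have hy0 : y = 0 := by rw [hydef, h, Nat.zero_mod]
        simp [hx0, hy0, hz0]
      · have hlt' : x / 2 * 2 ^ r + y / 2 < z := by
          rcases Nat.eq_zero_or_pos x with h' | h'
          · rw [h'] at hzxy ⊢; omega
          · have : (x / 2 + 1) * 2 ^ r ≤ x * 2 ^ r := Nat.mul_le_mul_right _ (by omega)
            rw [Nat.succ_mul] at this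
            omega
        have hy2 : y / 2 < 2 ^ r := by omega
        rw [h1 _ hlt', mul_comm, Nat.mul_add_div hq, Nat.div_eq_of_lt hy2, add_zero,
          Nat.mul_add_mod, Nat.mod_eq_of_lt hy2]
    refine Run.arith_seq x (by simp [Op.eval, E'.r8, h20, hxdef]) (by omega) ?_
    refine Run.arith_seq y (by simp [Op.eval, E'.r8, h20, hydef]) (by omega) ?_
    refine Run.arith_seq (x + y) (by simp [Op.eval]) (by omega) ?_
    refine Run.arith_seq ((x + y) % 2) (by simp [Op.eval, E'.r6]) (by omega) ?_
    refine Run.arith_seq (x / 2) (by simp [Op.eval, E'.r6]) (by omega) ?_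
    refine Run.arith_seq (y / 2) (by simp [Op.eval, E'.r6]) (by omega) ?_
    refine Run.arith_seq (x / 2 * 2 ^ r) (by simp [Op.eval, E'.r8]) (by omega) ?_
    refine Run.arith_seq (x / 2 * 2 ^ r + y / 2) (by simp [Op.eval]) (by omega) ?_
    refine Run.load_seq (x / 2 ^^^ y / 2) (by simpa using hload) ?_
    refine Run.arith_seq (2 * (x / 2 ^^^ y / 2)) (by simp [Op.eval, two_mul]) (by omega) ?_
    refine Run.arith_seq (x ^^^ y) (by simp [Op.eval, hxor]) (by omega) ?_
    refine Run.store_seq z (x ^^^ y) (by simp [h20]) (by simp) ?_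
    refine Run.arith (z + 1) (by simp [Op.eval, E'.r5, h20]) (by omega) ?_
    refine ⟨by simp, ?_, ?_, fun p hp => ?_, fun p hp => ?_⟩
    · repeat first | exact hF | refine Frame.setReg ?_ (by norm_num) | refine Frame.setMem ?_
    · simp only [State.setReg_mem, State.setMem_mem]
      split_ifs with h
      · simp [hxdef, hydef, ← h]
      · exact hz0
    · simp only [State.setReg_mem, State.setMem_mem]
      split_ifs with h
      · rw [h]
      · exact h1 p (by omega)
    · simp only [State.setReg_mem, State.setMem_mem]
      rw [if_neg (by omega), h2 p hp]
  · exact ⟨by simp, (Frame.refl 20 s).setReg (by norm_num), by simpa using h0, by simp, by simp⟩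
  · have hxle : x * 2 ^ r + 2 ^ r ≤ 2 ^ r * 2 ^ r := by
      rw [← Nat.succ_mul]; exact Nat.mul_le_mul_right _ hx
    rw [h.2.2.2.1 _ (by omega), mul_comm, Nat.mul_add_div hq, Nat.div_eq_of_lt hy, add_zero,
      Nat.mul_add_mod, Nat.mod_eq_of_lt hy]

/-- Set all weights to one. -/
def initWeights : Program :=
  .seq (.const 20 0) (.loop 20 11
    (.seq (.arith .add 21 14 20) (.seq (.store 21 5) (.arith .add 20 20 5))))

theorem run_initWeights (E : Env n q D s) (hB : cap n q D ≤ B) :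
    Run B initWeights s (2 ^ D * 4 + 2) fun s' => Frame 20 s s' ∧
      (∀ v < 2 ^ D, s'.mem (q * q + 2 ^ D + v) = 1) ∧
      ∀ p, p < q * q + 2 ^ D → s'.mem p = s.mem p := by
  unfold cap at hB
  refine Run.const_seq (by omega) ?_
  refine (Run.loop_const (fun x s' => s'.reg 20 = x ∧ Frame 20 s s' ∧
      (∀ v < x, s'.mem (q * q + 2 ^ D + v) = 1) ∧ ∀ p, p < q * q + 2 ^ D → s'.mem p = s.mem p)
      (2 ^ D) 3 ?_ ?_ ?_).mono (by omega) fun s' h => h.2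
  · rintro x s' ⟨h20, hF, -⟩
    rw [h20, (E.frame hF (by norm_num)).r11]
  · rintro x hx s' ⟨h20, hF, h1, h2⟩
    have E' := E.frame hF (by norm_num)
    refine Run.arith_seq (q * q + 2 ^ D + x) (by simp [Op.eval, E'.r14, h20]) (by omega) ?_
    refine Run.store_seq (q * q + 2 ^ D + x) 1 (by simp) (by simp [E'.r5]) ?_
    refine Run.arith (x + 1) (by simp [Op.eval, E'.r5, h20]) (by omega) ?_
    refine ⟨by simp, ((hF.setReg (by norm_num)).setMem).setReg (by norm_num), fun y hy => ?_,
      fun p hp => ?_⟩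
    · simp only [State.setReg_mem, State.setMem_mem]
      split_ifs with h
      · rfl
      · exact h1 y (by omega)
    · simp only [State.setReg_mem, State.setMem_mem]
      rw [if_neg (by omega), h2 p hp]
  · exact ⟨by simp, (Frame.refl 20 s).setReg (by norm_num), by simp, by simp⟩

end WordRAM

/-! ### The complete program -/

namespace WordRAM

variable {B n q D : ℕ} {s s' : State}

/-- Write `n` disjoint singletons. -/
def writeSingletons : Program :=
  .seq (.const 20 0) (.seq (.loop 20 0 (.seq (.store 20 20) (.arith .add 20 20 5)))
    (.seq (.const 1 1) (.const 2 0)))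

theorem run_writeSingletons (h0 : s.reg 0 = n) (h5 : s.reg 5 = 1) (hB : n + 1 ≤ B) :
    Run B writeSingletons s (n * 3 + 4) fun s' =>
      s'.reg 0 = n ∧ s'.reg 1 = 1 ∧ s'.reg 2 = 0 ∧ ∀ i < n, s'.mem i = i := by
  refine Run.mono (T := (n * 3 + 1) + 2 + 1) (Run.const_seq (by omega) (Run.seq
    ((Run.loop_const (fun x s' => s'.reg 20 = x ∧ s'.reg 0 = n ∧ s'.reg 5 = 1 ∧
      ∀ i < x, s'.mem i = i) n 2 ?_ ?_ ?_).mono le_rfl ?_))) (by omega) fun _ h => h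
  · rintro x s' ⟨h20, h0, -⟩
    rw [h20, h0]
  · rintro x hx s' ⟨h20, h0, h5, h1⟩
    refine Run.store_seq x x h20 h20 ?_
    refine Run.arith (x + 1) (by simp [Op.eval, h20, h5]) (by omega) ?_
    refine ⟨by simp, by simp [h0], by simp [h5], fun i hi => ?_⟩
    simp only [State.setReg_mem, State.setMem_mem]
    split_ifs with h
    · exact h.symm
    · exact h1 i (by omega)
  · exact ⟨by simp, by simp [h0], by simp [h5], by simp⟩
  · rintro s' ⟨-, h0, -, h1⟩
    refine Run.const_seq (by omega) ?_
    refine Run.const (by omega) ?_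
    exact ⟨by simp [h0], by simp, by simp, by simpa using h1⟩

/-- Write the family that comes from a code with `2 ^ D ≥ n` words. -/
def writeFamily : Program :=
  .seq (.const 11 1) (.seq (.const 12 0)
  (.seq (.loop 11 0 (.seq (.arith .add 11 11 11) (.arith .add 12 12 5)))
  (.seq (.arith .mul 13 8 12) (.seq (.arith .add 14 10 11) (.seq (.arith .add 15 14 11)
  (.seq (.arith .add 16 15 8) (.seq writeTable (.seq initWeights (.seq writeCode
  (.seq (.arith .mul 0 13 8) (.seq (.arith .add 1 13 4) (.arith .add 2 16 4))))))))))))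

/-- The number of steps of `writeFamily`. -/
def familyTime (n q D : ℕ) : ℕ :=
  q * D * (q * D * 11 + 2 ^ D * 28 + D * 13 + n * 7 + 10) + q * q * 14 + 2 ^ D * 4 + D * 3 + 16

theorem run_writeFamily {r : ℕ} (h0 : s.reg 0 = n) (h4 : s.reg 4 = 0) (h5 : s.reg 5 = 1)
    (h6 : s.reg 6 = 2) (h8 : s.reg 8 = 2 ^ r) (h10 : s.reg 10 = 2 ^ r * 2 ^ r)
    (hm : ∀ p, s.mem p = 0) (hD : D = Nat.clog 2 n) (hB : cap n (2 ^ r) D ≤ B) :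
    Run B writeFamily s (familyTime n (2 ^ r) D) fun s' =>
      s'.reg 0 = 2 ^ r * D * 2 ^ r ∧ s'.reg 1 = 2 ^ r * D ∧ ∃ col : ℕ → ℕ → ℕ,
        (∀ l < 2 ^ r * D, ∀ u < 2 ^ D, col l u < 2 ^ r) ∧
        (∀ l < 2 ^ r * D, ∀ u < 2 ^ D, ∀ v < 2 ^ D, col l (u ^^^ v) = col l u ^^^ col l v) ∧
        (∀ v, 1 ≤ v → v < 2 ^ D → zeros col (2 ^ r * D) v ≤ 3 * D - 1) ∧
        ∀ u < n, ∀ l < 2 ^ r * D,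
          s'.mem (s'.reg 2 + u * (2 ^ r * D) + l) = l * 2 ^ r + col l u := by
  have hn : n ≤ 2 ^ D := by rw [hD]; exact Nat.le_pow_clog (by norm_num) n
  have hB' := hB
  unfold cap at hB'
  have hDlt : D < 2 ^ D := Nat.lt_two_pow_self
  refine Run.mono (T := (D * 3 + 1) + ((2 ^ r * 2 ^ r * 14 + 2) + ((2 ^ D * 4 + 2) +
    ((2 ^ r * D * (2 ^ r * D * 11 + 2 ^ D * 28 + D * 13 + n * 7 + 10) + 2) + 3)) + 1 + 1 + 1 + 1) + 1 + 1)
    (Run.const_seq (by omega) (Run.const_seq (by omega) (Run.seq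
    ((Run.loop_const (fun x s' => s'.reg 11 = 2 ^ x ∧ s'.reg 12 = x ∧ Frame 11 s s' ∧
      s'.mem = s.mem) D 2 ?_ ?_ ?_).mono le_rfl ?_)))) (by unfold familyTime; omega) fun _ h => h
  · rintro x s' ⟨h11, -, hF, -⟩
    -- Doubling while `2 ^ x < n` stops exactly at `x = ⌈log₂ n⌉`.
    rw [h11, hF 0 (by norm_num), h0, hD, Nat.lt_clog_iff_pow_lt (by norm_num)]
  · rintro x hx s' ⟨h11, h12, hF, hm'⟩
    have hle : 2 ^ (x + 1) ≤ 2 ^ D := Nat.pow_le_pow_right (by norm_num) hx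
    refine Run.arith_seq (2 ^ (x + 1)) (by simp [Op.eval, h11, pow_succ, mul_two]) (by omega) ?_
    refine Run.arith (x + 1) (by simp [Op.eval, h12, hF 5 (by norm_num), h5]) (by omega) ?_
    exact ⟨by simp, by simp, (hF.setReg (by norm_num)).setReg (by norm_num), by simpa using hm'⟩
  · refine ⟨by simp, by simp, ?_, by simp⟩
    exact ((Frame.refl _ _).setReg (by norm_num)).setReg (by norm_num)
  · rintro s₁ ⟨h11, h12, hF, hm₁⟩
    have h0' : s₁.reg 0 = n := by rw [hF 0 (by norm_num), h0]
    have h4' : s₁.reg 4 = 0 := by rw [hF 4 (by norm_num), h4]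
    have h5' : s₁.reg 5 = 1 := by rw [hF 5 (by norm_num), h5]
    have h6' : s₁.reg 6 = 2 := by rw [hF 6 (by norm_num), h6]
    have h8' : s₁.reg 8 = 2 ^ r := by rw [hF 8 (by norm_num), h8]
    have h10' : s₁.reg 10 = 2 ^ r * 2 ^ r := by rw [hF 10 (by norm_num), h10]
    refine Run.arith_seq (2 ^ r * D) (by simp [Op.eval, h8', h12]) (by omega) ?_
    refine Run.arith_seq (2 ^ r * 2 ^ r + 2 ^ D) (by simp [Op.eval, h10', h11]) (by omega) ?_
    refine Run.arith_seq (2 ^ r * 2 ^ r + 2 ^ D + 2 ^ D) (by simp [Op.eval, h11]) (by omega) ?_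
    refine Run.arith_seq (2 ^ r * 2 ^ r + 2 ^ D + 2 ^ D + 2 ^ r) (by simp [Op.eval, h8']) (by omega) ?_
    generalize hs₂ : State.setReg _ 16 _ = s₂
    have hm₂ : ∀ p, s₂.mem p = 0 := by
      intro p; rw [← hs₂]; simp [hm₁, hm]
    have E₂ : Env n (2 ^ r) D s₂ := by
      rw [← hs₂]
      constructor <;> simp [*]
    refine Run.seq ((run_writeTable E₂ hB (hm₂ 0)).mono le_rfl ?_)
    rintro s₃ ⟨hF₃, htab₃, hm₃⟩
    have E₃ := E₂.frame hF₃ (by norm_num)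
    refine Run.seq ((run_initWeights E₃ hB).mono le_rfl ?_)
    rintro s₄ ⟨hF₄, hw₄, hm₄⟩
    have E₄ := E₃.frame hF₄ (by norm_num)
    have h2D : 0 < 2 ^ D := by positivity
    refine Run.seq ((run_writeCode E₄ hB hn
      (by rw [hm₄ _ (by omega), hm₃ _ (by omega), hm₂]) hw₄ fun x hx y hy => ?_).mono le_rfl ?_)
    · have hxle : x * 2 ^ r + 2 ^ r ≤ 2 ^ r * 2 ^ r := by
        rw [← Nat.succ_mul]; exact Nat.mul_le_mul_right _ hx
      rw [hm₄ _ (by omega), htab₃ x hx y hy]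
    · rintro s₅ ⟨hF₅, col, hlt, hxor, hz, hout⟩
      have E₅ := E₄.frame hF₅ (by norm_num)
      refine Run.arith_seq (2 ^ r * D * 2 ^ r) (by simp [Op.eval, E₅.r13, E₅.r8]) (by omega) ?_
      refine Run.arith_seq (2 ^ r * D) (by simp [Op.eval, E₅.r13, E₅.r4]) (by omega) ?_
      refine Run.arith (2 ^ r * 2 ^ r + 2 ^ D + 2 ^ D + 2 ^ r) (by simp [Op.eval, E₅.r16, E₅.r4])
        (by omega) ?_
      exact ⟨by simp, by simp, col, hlt, hxor, hz, by simpa using hout⟩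

/-- The construction of a robust union-free family. -/
def robustUFF : Program :=
  .seq (.const 5 1) (.seq (.const 6 2) (.seq (.const 7 3) (.seq (.arith .mul 7 7 1)
  (.seq (.arith .mul 7 7 3) (.seq (.const 8 1) (.seq (.arith .mul 9 8 2)
  (.seq (.loop 9 7 (.seq (.arith .add 8 8 8) (.arith .add 9 9 9)))
  (.seq (.arith .mul 10 8 8) (.ite 10 0 writeFamily writeSingletons)))))))))

/-- Doubling `q` and `q a` together finds the least power of two with `q a ≥ 3 k b` without
division. `T` and `Q` are left open so that the two branches can be treated separately. -/
theorem run_robustUFF {k a b r T : ℕ} {Q : State → Prop} (hb : 1 ≤ b) (h3 : 3 * k * b + 3 ≤ B)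
    (hr : ∀ i, 2 ^ i * a < 3 * k * b ↔ i < r) (hra : 2 ^ r * a ≤ B) (ha : 1 ≤ a)
    (hq : 2 ^ r * 2 ^ r ≤ B)
    (hlarge : 2 ^ r * 2 ^ r < n → ∀ s : State, s.reg 0 = n → s.reg 4 = 0 → s.reg 5 = 1 →
      s.reg 6 = 2 → s.reg 8 = 2 ^ r → s.reg 10 = 2 ^ r * 2 ^ r → (∀ p, s.mem p = 0) →
      Run B writeFamily s T Q)
    (hsmall : ¬ 2 ^ r * 2 ^ r < n → ∀ s : State, s.reg 0 = n → s.reg 5 = 1 →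
      Run B writeSingletons s T Q) :
    Run B robustUFF (start [n, k, a, b]) (r * 3 + T + 10) Q := by
  have h2r : 1 ≤ 2 ^ r := Nat.one_le_two_pow
  have har : 2 ^ r ≤ 2 ^ r * a := Nat.le_mul_of_pos_right _ ha
  have ha' : a ≤ 2 ^ r * a := Nat.le_mul_of_pos_left _ h2r
  have hkb : 3 * k ≤ 3 * k * b := Nat.le_mul_of_pos_right _ hb
  -- The input has four entries, so `R₄` starts with the default value `0`; it is never assigned and
  -- serves as the constant zero.
  have hstart : ∀ i, 4 ≤ i → (start [n, k, a, b]).reg i = 0 := fun i hi => by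
    simp only [start, List.getD_eq_getElem?_getD]
    rw [List.getElem?_eq_none (by simpa using hi)]
    rfl
  refine Run.mono (T := (r * 3 + 1) + ((T + 1) + 1) + 1 + 1 + 1 + 1 + 1 + 1 + 1) ?_ (by omega)
    fun _ h => h
  refine Run.const_seq (by omega) (Run.const_seq (by omega) (Run.const_seq (by omega) ?_))
  refine Run.arith_seq (3 * k) (by simp [Op.eval, start]) (by omega) ?_
  refine Run.arith_seq (3 * k * b) (by simp [Op.eval, start]) (by omega) ?_
  refine Run.const_seq (by omega) ?_
  refine Run.arith_seq a (by simp [Op.eval, start]) (by omega) ?_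
  refine Run.seq ((Run.loop_const (fun x s' => s'.reg 9 = 2 ^ x * a ∧ s'.reg 8 = 2 ^ x ∧
    s'.reg 7 = 3 * k * b ∧ s'.reg 0 = n ∧ s'.reg 4 = 0 ∧ s'.reg 5 = 1 ∧ s'.reg 6 = 2 ∧
    ∀ p, s'.mem p = 0) r 2 ?_ ?_ ?_).mono le_rfl ?_)
  · rintro x s' ⟨h9, -, h7, -⟩
    rw [h9, h7, hr]
  · rintro x hx s' ⟨h9, h8, h7, h0, h4, h5, h6, hm⟩
    have hle : 2 ^ (x + 1) ≤ 2 ^ r := Nat.pow_le_pow_right (by norm_num) hx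
    have hle' : 2 ^ (x + 1) * a ≤ 2 ^ r * a := Nat.mul_le_mul_right _ hle
    refine Run.arith_seq (2 ^ (x + 1)) (by simp [Op.eval, h8, pow_succ, mul_two]) (by omega) ?_
    refine Run.arith (2 ^ (x + 1) * a) (by simp [Op.eval, h9]; ring) (by omega) ?_
    simp [h7, h0, h4, h5, h6, hm]
  · simp [hstart]
    simp [start]
  · rintro s' ⟨-, h8, -, h0, h4, h5, h6, hm⟩
    refine Run.arith_seq (2 ^ r * 2 ^ r) (by simp [Op.eval, h8]) hq ?_
    refine Run.ite (fun hc => ?_) fun hc => ?_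
    · refine hlarge (by simpa [h0] using hc) _ ?_ ?_ ?_ ?_ ?_ ?_ ?_ <;> simp [*]
    · refine hsmall (by simpa [h0] using hc) _ ?_ ?_ <;> simp [*]

end WordRAM

/-! ### The trivial family and numerical estimates -/

theorem isRobustUFF_singletons (n k : ℕ) {α : ℝ} (hα : 0 < α) :
    IsRobustUFF (fun i : Fin n => ({i} : Finset (Fin n))) 1 k α := by
  refine ⟨fun i => by simp, fun j hj => ?_⟩
  have : ({j 0} : Finset (Fin n)) ∩ Finset.univ.biUnion (fun i : Fin k => {j i.succ}) = ∅ := by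
    ext x
    simp only [Finset.mem_inter, Finset.mem_singleton, Finset.mem_biUnion, Finset.mem_univ,
      true_and, Finset.notMem_empty, iff_false, not_and, not_exists]
    rintro rfl i h
    exact Fin.succ_ne_zero i (hj h).symm
  simpa [this] using hα

theorem mul_self_le_two_mul_two_pow (D : ℕ) : D * D ≤ 2 * 2 ^ D := by
  induction D with
  | zero => simp
  | succ D ih =>
    rcases lt_or_ge D 3 with h | h
    · interval_cases D <;> norm_num
    · rw [pow_succ]
      nlinarith

/-- From `q² < n` and `D² ≤ 2 * 2 ^ D ≤ 4n` follows `qD = O(n)`, so each of the `qD` columns costs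
`O(n)`. -/
theorem familyTime_le {n q D : ℕ} (hq : 1 ≤ q) (hD : 1 ≤ D) (hM : 2 ^ D ≤ 2 * n)
    (hqn : q * q < n) : WordRAM.familyTime n q D ≤ 200 * (n * (q * D)) := by
  have h1 : D < 2 ^ D := Nat.lt_two_pow_self
  have h2 := mul_self_le_two_mul_two_pow D
  have h3 : q * D ≤ 3 * n := by nlinarith [sq_nonneg ((q : ℤ) - D)]
  have h4 : 1 ≤ q * D := Nat.mul_pos hq hD
  have h5 : n ≤ n * (q * D) := Nat.le_mul_of_pos_right _ h4
  -- `132 = 33 + 56 + 26 + 7 + 10`, using `qD ≤ 3n`, `2 ^ D ≤ 2n`, `D ≤ 2n` and `1 ≤ n`.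
  have h6 : q * D * (q * D * 11 + 2 ^ D * 28 + D * 13 + n * 7 + 10) ≤ q * D * (132 * n) :=
    Nat.mul_le_mul_left _ (by omega)
  have h7 : q * D * (132 * n) = 132 * (n * (q * D)) := by ring
  unfold WordRAM.familyTime
  omega

/-- Every term is at most cubic in `X` up to a constant, and `X ≥ 4` absorbs the constant: `30 ≤ X ^
3`. -/
theorem cap_le {n q D X : ℕ} (hX : 4 ≤ X) (hn : n ≤ X) (hM : 2 ^ D ≤ 2 * n) (hqn : q * q < n) :
    WordRAM.cap n q D ≤ X ^ 10 := by
  have h1 : D < 2 ^ D := Nat.lt_two_pow_self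
  have hq : q ≤ X := by nlinarith
  have hD : D ≤ 2 * X := by omega
  have h2 : q * D ≤ X * (2 * X) := Nat.mul_le_mul hq hD
  have h3 : n * (q * D) ≤ X * (X * (2 * X)) := Nat.mul_le_mul hn h2
  have h4 : q * D * q ≤ X * (2 * X) * X := Nat.mul_le_mul h2 hq
  have h5 : 2 ^ (3 * D) ≤ (2 * X) ^ 3 := by
    rw [mul_comm, pow_mul]
    exact Nat.pow_le_pow_left (by omega) 3
  have h6 : WordRAM.cap n q D ≤ 30 * X ^ 3 := by
    unfold WordRAM.cap
    have e1 : X * (X * (2 * X)) = 2 * X ^ 3 := by ring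
    have e2 : X * (2 * X) * X = 2 * X ^ 3 := by ring
    have e3 : (2 * X) ^ 3 = 8 * X ^ 3 := by ring
    have e4 : 4 * (X * (2 * X)) ≤ 2 * X ^ 3 := by
      calc 4 * (X * (2 * X)) ≤ X * (X * (2 * X)) := Nat.mul_le_mul_right _ hX
        _ = _ := e1
    have e5 : 16 * X ≤ X ^ 3 := by nlinarith
    omega
  have h7 : 30 * X ^ 3 ≤ X ^ 3 * X ^ 3 :=
    Nat.mul_le_mul_right _ ((by norm_num : 30 ≤ 4 ^ 3).trans (Nat.pow_le_pow_left hX 3))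
  rw [← pow_add] at h7
  exact h6.trans (h7.trans (Nat.pow_le_pow_right (by omega) (by norm_num)))

/-- From `(D - 1) log 2 ≤ log n` and `log 2 ≤ log n` one gets `D ≤ (2 / log 2) log n`, and `2 / log
2 < 3`. -/
theorem clog_le_three_mul_log {n : ℕ} (hn : 2 ≤ n) : (Nat.clog 2 n : ℝ) ≤ 3 * Real.log n := by
  have h1 : 2 ^ (Nat.clog 2 n - 1) ≤ n := (Nat.pow_pred_clog_lt_self (by norm_num) (by omega)).le
  have h2 : (2 : ℝ) ^ (Nat.clog 2 n - 1) ≤ n := by exact_mod_cast h1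
  have h3 := Real.log_le_log (by positivity) h2
  rw [Real.log_pow] at h3
  have h4 : Real.log 2 ≤ Real.log n := Real.log_le_log (by norm_num) (by exact_mod_cast hn)
  have h5 : 1 ≤ Nat.clog 2 n := Nat.clog_pos (by norm_num) hn
  rw [Nat.cast_sub h5] at h3
  have h6 := Real.log_two_gt_d9
  have h7 : (1 : ℝ) ≤ Nat.clog 2 n := by exact_mod_cast h5
  push_cast at h3
  nlinarith

theorem exists_two_pow_mul_bounds {a N : ℕ} (ha : 1 ≤ a) (haN : a ≤ 2 * N) :
    ∃ r, (∀ i, 2 ^ i * a < N ↔ i < r) ∧ 2 ^ r * a ≤ 2 * N := by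
  have hex : ∃ r, N ≤ 2 ^ r * a :=
    ⟨N, Nat.lt_two_pow_self.le.trans (Nat.le_mul_of_pos_right _ ha)⟩
  refine ⟨Nat.find hex, fun i => ?_, ?_⟩
  · rw [Nat.lt_find_iff]
    refine ⟨fun h j hj => not_le.2 (lt_of_le_of_lt ?_ h), fun h => not_le.1 (h i le_rfl)⟩
    exact Nat.mul_le_mul_right _ (Nat.pow_le_pow_right (by norm_num) hj)
  · rcases Nat.eq_zero_or_pos (Nat.find hex) with h | h
    · rw [h]; simpa using haN
    · have := Nat.find_min hex (Nat.sub_lt h one_pos)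
      have e : 2 ^ Nat.find hex = 2 * 2 ^ (Nat.find hex - 1) := by
        rw [← pow_succ', Nat.sub_add_cancel h]
      rw [e, mul_assoc]
      omega

/-! ### The main theorem -/

open WordRAM in
theorem mainTheorem5 :
    ∃ (P : WordRAM.Program) (C : ℝ) (c : ℕ),
      ∀ (n k a b : ℕ) (α : ℝ), 2 ≤ n → 1 ≤ k → 0 < α → α ≤ 1 →
        0 < b → α / 2 ≤ (a : ℝ) / (b : ℝ) → (a : ℝ) / (b : ℝ) ≤ α →
        ∃ (m d t : ℕ) (F : Fin n → Finset (Fin m)) (s : WordRAM.State),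
          WordRAM.Exec ((n + k + b) ^ c) P (WordRAM.start [n, k, a, b]) t s ∧
          s.Outputs d F ∧
          IsRobustUFF F d k α ∧
          (m : ℝ) ≤ C * ((k : ℝ) ^ 2 * Real.log n / α ^ 2) ∧
          (d : ℝ) ≤ C * ((k : ℝ) * Real.log n / α) ∧
          (t : ℝ) ≤ C * ((n : ℝ) * ((k : ℝ) * Real.log n / α)) := by
  -- In the code case the constants come out as `432` for `m`, `36` for `d` and `7560` for the time;
  -- `20000` is generous. The exponent is that of `cap_le`.
  refine ⟨robustUFF, 20000, 10, fun n k a b α hn hk hα hα1 hb h1 h2 => ?_⟩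
  have hb' : (0 : ℝ) < b := by exact_mod_cast hb
  rw [le_div_iff₀ hb'] at h1
  rw [div_le_iff₀ hb'] at h2
  have ha : 1 ≤ a := by
    have : (0 : ℝ) < a := lt_of_lt_of_le (by positivity) h1
    exact_mod_cast this
  have hab : a ≤ b := by
    have : (a : ℝ) ≤ b := h2.trans (by nlinarith)
    exact_mod_cast this
  have hbkb : b ≤ 3 * k * b := Nat.le_mul_of_pos_left _ (by omega)
  obtain ⟨r, hr, hra⟩ := exists_two_pow_mul_bounds (N := 3 * k * b) ha (by omega)
  set X := n + k + b with hX
  have hkX : k * b ≤ X * X := Nat.mul_le_mul (by omega) (by omega)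
  have hXX : X ≤ X * X := Nat.le_mul_self X
  have hX2 : 16 ≤ X * X := Nat.mul_le_mul (show 4 ≤ X by omega) (show 4 ≤ X by omega)
  have hX4 : 16 * (X * X) ≤ X ^ 4 := by
    calc 16 * (X * X) ≤ (X * X) * (X * X) := Nat.mul_le_mul_right _ hX2
      _ = X ^ 4 := by ring
  have hX10 : X ^ 4 ≤ X ^ 10 := Nat.pow_le_pow_right (by omega) (by norm_num)
  have hqa : 2 ^ r ≤ 2 ^ r * a := Nat.le_mul_of_pos_right _ ha
  have e3 : 3 * k * b = 3 * (k * b) := by ring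
  have hqX : 2 ^ r ≤ X ^ 4 := by omega
  have hqq : 2 ^ r * 2 ^ r ≤ X ^ 10 := by
    calc 2 ^ r * 2 ^ r ≤ X ^ 4 * X ^ 4 := Nat.mul_le_mul hqX hqX
      _ = X ^ 8 := by ring
      _ ≤ X ^ 10 := Nat.pow_le_pow_right (by omega) (by norm_num)
  have hq1 : 1 ≤ 2 ^ r := Nat.one_le_two_pow
  have hrq : r < 2 ^ r := Nat.lt_two_pow_self
  -- Minimality gives `q a ≤ 6 k b`, and `a ≥ α b / 2` loses another factor of two.
  have hqα : (2 ^ r : ℕ) * α ≤ 12 * k := by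
    have h3 : ((2 ^ r : ℕ) : ℝ) * a ≤ 2 * (3 * k * b) := by exact_mod_cast hra
    have h4 : ((2 ^ r : ℕ) : ℝ) * (α / 2 * b) ≤ (2 ^ r : ℕ) * a := by gcongr
    have h5 : ((2 ^ r : ℕ) : ℝ) * α * b ≤ 12 * k * b := by linarith
    exact le_of_mul_le_mul_right h5 hb'
  have hαk : 3 * (k : ℝ) ≤ (2 ^ r : ℕ) * α := by
    have h3 : 3 * k * b ≤ 2 ^ r * a := not_lt.1 fun h => lt_irrefl r ((hr r).1 h)
    have h4 : 3 * (k : ℝ) * b ≤ (2 ^ r : ℕ) * a := by exact_mod_cast h3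
    have h5 : ((2 ^ r : ℕ) : ℝ) * a ≤ (2 ^ r : ℕ) * (α * b) := by gcongr
    have h6 : 3 * (k : ℝ) * b ≤ (2 ^ r : ℕ) * α * b := by linarith
    exact le_of_mul_le_mul_right h6 hb'
  have hqk : ((2 ^ r : ℕ) : ℝ) ≤ 12 * (k / α) := by
    rw [← mul_div_assoc, le_div_iff₀ hα]; exact hqα
  have hk1 : (1 : ℝ) ≤ k := by exact_mod_cast hk
  have hy : (1 : ℝ) ≤ k / α := by
    rw [le_div_iff₀ hα]; linarith
  have hlog : 0.69 ≤ Real.log n := by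
    have h4 : Real.log 2 ≤ Real.log n := Real.log_le_log (by norm_num) (by exact_mod_cast hn)
    have h6 := Real.log_two_gt_d9
    linarith
  have eq1 : (k : ℝ) ^ 2 * Real.log n / α ^ 2 = (k / α) ^ 2 * Real.log n := by
    field_simp
  have eq2 : (k : ℝ) * Real.log n / α = k / α * Real.log n := by
    field_simp
  rw [eq1, eq2]
  have hn' : (2 : ℝ) ≤ n := by exact_mod_cast hn
  -- For `q² ≥ n` the singletons are small enough; for `q² < n` the work per column is linear in
  -- `n`.
  by_cases hc : 2 ^ r * 2 ^ r < n
  · set D := Nat.clog 2 n with hD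
    have hD1 : 1 ≤ D := Nat.clog_pos (by norm_num) hn
    have hDM : 2 ^ D ≤ 2 * n := by
      have h := Nat.pow_pred_clog_lt_self (b := 2) (by norm_num) (show 1 < n by omega)
      rw [← hD] at h
      have e : 2 ^ D = 2 * 2 ^ (D - 1) := by rw [← pow_succ', Nat.sub_add_cancel hD1]
      have : 2 ^ (D - 1) < n := h
      omega
    have hDlog : (D : ℝ) ≤ 3 * Real.log n := clog_le_three_mul_log hn
    have hnD : n ≤ 2 ^ D := Nat.le_pow_clog (by norm_num) n
    obtain ⟨t, s, he, ht, hs0, hs1, col, hlt, hxor, hz, hout⟩ :=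
      run_robustUFF (n := n) (r := r) (B := X ^ 10) hb (by omega) hr (by omega) ha hqq
        (fun _ s h0 h4 h5 h6 h8 h10 hm => run_writeFamily h0 h4 h5 h6 h8 h10 hm hD
          (cap_le (by omega) (by omega) hDM hc)) fun h => absurd hc h
    have hT := familyTime_le hq1 hD1 hDM hc
    refine ⟨2 ^ r * D * 2 ^ r, 2 ^ r * D, t, codeSet n _ (2 ^ r) (2 ^ r * D) col, s, he,
      ⟨hs0, hs1, fun i => ?_⟩, ?_, ?_, ?_, ?_⟩
    · rw [map_codeSet i fun l hl => hlt l hl i (by omega)]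
      exact Finset.image_congr fun l hl => (hout i i.2 l (by simpa using hl)).symm
    · refine isRobustUFF_codeSet hnD hlt hxor hz ?_
      have h3D : ((3 * D - 1 : ℕ) : ℝ) = 3 * D - 1 := by
        rw [Nat.cast_sub (by omega)]; push_cast; ring
      have hD0 : (0 : ℝ) ≤ D := Nat.cast_nonneg _
      rw [h3D, Nat.cast_mul]
      -- `k (3D - 1) < 3 k D ≤ q α D = α d`, by `hαk`.
      nlinarith
    · clear hlt hxor hz hout
      have h3 : (0 : ℝ) ≤ (2 ^ r : ℕ) := Nat.cast_nonneg _
      have h4 : ((2 ^ r : ℕ) : ℝ) * D * (2 ^ r : ℕ)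
          ≤ 12 * (k / α) * (3 * Real.log n) * (12 * (k / α)) := by gcongr
      rw [Nat.cast_mul, Nat.cast_mul]
      have h5 : (0 : ℝ) ≤ (k / α) ^ 2 * Real.log n := by positivity
      linarith
    · have h4 : ((2 ^ r : ℕ) : ℝ) * D ≤ 12 * (k / α) * (3 * Real.log n) := by gcongr
      rw [Nat.cast_mul]
      have h5 : (0 : ℝ) ≤ (k / α) * Real.log n := by positivity
      linarith
    · have h4 : ((2 ^ r : ℕ) : ℝ) * D ≤ 12 * (k / α) * (3 * Real.log n) := by gcongr
      have h5 : n ≤ n * (2 ^ r * D) := Nat.le_mul_of_pos_right _ (Nat.mul_pos hq1 hD1)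
      have h6 : 2 ^ r ≤ 2 ^ r * 2 ^ r := Nat.le_mul_of_pos_right _ hq1
      have h7 : t ≤ 210 * (n * (2 ^ r * D)) := by omega
      have h8 : (t : ℝ) ≤ 210 * (n * ((2 ^ r : ℕ) * D)) := by exact_mod_cast h7
      have h9 : (n : ℝ) * ((2 ^ r : ℕ) * D) ≤ n * (12 * (k / α) * (3 * Real.log n)) := by gcongr
      have h10 : (0 : ℝ) ≤ n * ((k / α) * Real.log n) := by positivity
      linarith
  · obtain ⟨t, s, he, ht, hs0, hs1, hs2, hout⟩ :=
      run_robustUFF (n := n) (r := r) (B := X ^ 10) hb (by omega) hr (by omega) ha hqq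
        (fun h => absurd h hc) fun _ s h0 h5 => run_writeSingletons h0 h5 (by omega)
    have hylog : (0.69 : ℝ) ≤ k / α * Real.log n := by nlinarith
    refine ⟨n, 1, t, fun i => {i}, s, he, ⟨hs0, hs1, fun i => ?_⟩, isRobustUFF_singletons n k hα,
      ?_, ?_, ?_⟩
    · simp [hs2, hout i i.2]
    · have h3 : (n : ℝ) ≤ (2 ^ r : ℕ) * (2 ^ r : ℕ) := by exact_mod_cast not_lt.1 hc
      have h4 : ((2 ^ r : ℕ) : ℝ) * (2 ^ r : ℕ) ≤ 12 * (k / α) * (12 * (k / α)) := by gcongr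
      have h5 : (k / α) ^ 2 * 0.69 ≤ (k / α) ^ 2 * Real.log n := by gcongr
      have h6 : 0 ≤ (k / α) ^ 2 := by positivity
      linarith
    · rw [Nat.cast_one]
      linarith
    -- The `r` doublings are bounded crudely by `r < 2 ^ r = O(k/α)`.
    · have h7 : t ≤ 20 * n + 3 * 2 ^ r := by omega
      have h8 : (t : ℝ) ≤ 20 * n + 3 * (2 ^ r : ℕ) := by exact_mod_cast h7
      have h9 : (n : ℝ) * 0.69 ≤ n * (k / α * Real.log n) := by gcongr
      have h10 : k / α * 0.69 ≤ k / α * Real.log n := by gcongr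
      have h11 : 1 * (k / α * Real.log n) ≤ n * (k / α * Real.log n) := by
        gcongr
        linarith
      linarith
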